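/- Let $k$ be an algebraically closed field of characteristic zero. A configuration of six distinct points $Z = \{z_1, \dots, z_6\} \subset \mathbb{P}^2$ over $k$, no three of them collinear, is called star-free if it has no star point, that is, if there is no point $x \in \mathbb{P}^2 \setminus Z$ such that, for some ordering of the six points, the lines $\overline{z_1 z_2}$, $\overline{z_3 z_4}$ and $\overline{z_5 z_6}$ all pass through $x$. We regard $Z$ as a reduced subscheme of length $6$; the $\mathrm{PGL}_3$-orbit closure of $Z$ is the Zariski closure of the orbit of $Z$ in the Hilbert scheme of length $6$ subschemes of $\mathbb{P}^2$. A finite subscheme of $\mathbb{P}^2$ is curvilinear if it is contained in a smooth curve; its cycle is the sum of the points of its support, each weighted by the length of the local ring there. Let $W \subset \mathbb{P}^2$ be a curvilinear subscheme of length $6$. (1) Suppose that the cycle of $W$ is $p + q + 4r$, where $p, q, r$ are distinct points, and that the tangent line $T_rW$ contains neither $p$ nor $q$. Then $W$ does not lie in the $\mathrm{PGL}_3$-orbit closure of any star-free configuration $Z$. (2) Suppose that the cycle of $W$ is $2p + 4r$, where $p, r$ are distinct points, and that the tangent line $T_rW$ does not contain $p$. Then $W$ does not lie in the $\mathrm{PGL}_3$-orbit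 closure of any star-free configuration $Z$. -/

import Mathlib

open scoped LinearAlgebra.Projectivization MatrixGroups

noncomputable section

attribute [local instance] MvPolynomial.gradedAlgebra

/-- The part of degree `d` of an ideal of `k[x₀, x₁, x₂]`, as a subspace of the space of ternary
forms of degree `d`. -/
def degreePart {k : Type*} [Field k] (I : Ideal (MvPolynomial (Fin 3) k)) (d : ℕ) :
    Submodule k (MvPolynomial.homogeneousSubmodule (Fin 3) k d) :=
  (I.restrictScalars k).comap (MvPolynomial.homogeneousSubmodule (Fin 3) k d).subtype

/-- A finite closed subscheme of length `n` of the projective plane `ℙ²` over `k`, given by its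
saturated homogeneous ideal in `k[x₀, x₁, x₂]`. (Closed subschemes of `ℙ²` correspond bijectively
to saturated homogeneous ideals; being finite of length `n` means that the Hilbert polynomial is
the constant `n`.) -/
@[ext]
structure PlaneSubscheme (k : Type*) [Field k] (n : ℕ) where
  /-- the homogeneous ideal -/
  ideal : Ideal (MvPolynomial (Fin 3) k)
  homogeneous : ideal.IsHomogeneous (MvPolynomial.homogeneousSubmodule (Fin 3) k)
  saturated : ∀ f, (∀ i, MvPolynomial.X i * f ∈ ideal) → f ∈ ideal
  length_eq : ∀ᶠ d in Filter.atTop,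
    Module.finrank k (MvPolynomial.homogeneousSubmodule (Fin 3) k d ⧸ degreePart ideal d) = n

/-- The homogeneous prime ideal of a point `p` of `ℙ²`: the kernel of the restriction of polynomials
to the line in `k³` which `p` represents. -/
def pointIdeal {k : Type*} [Field k] (p : ℙ k (Fin 3 → k)) : Ideal (MvPolynomial (Fin 3) k) :=
  RingHom.ker
    (MvPolynomial.aeval (R := k) (fun i => Polynomial.C (p.rep i) * Polynomial.X (R := k)))

instance pointIdeal_isPrime {k : Type*} [Field k] (p : ℙ k (Fin 3 → k)) :
    (pointIdeal p).IsPrime :=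
  RingHom.ker_isPrime _

namespace PlaneSubscheme

/-- The point `p` lies on (the support of) `W`. -/
def HasPoint {k : Type*} [Field k] {n : ℕ} (W : PlaneSubscheme k n) (p : ℙ k (Fin 3 → k)) :
    Prop :=
  W.ideal ≤ pointIdeal p

/-- The ideal of `W` in the local ring of `ℙ²` at `p`. The local ring is the ring of fractions
`f / g` of forms of the same degree with `g` not vanishing at `p`, and its ideal consists of the
fractions with numerator in the homogeneous ideal of `W`. -/
def localIdeal {k : Type*} [Field k] {n : ℕ} (W : PlaneSubscheme k n) (p : ℙ k (Fin 3 → k)) :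
    Ideal (HomogeneousLocalization.AtPrime
      (MvPolynomial.homogeneousSubmodule (Fin 3) k) (pointIdeal p)) :=
  (W.ideal.map (algebraMap (MvPolynomial (Fin 3) k) (Localization.AtPrime (pointIdeal p)))).comap
    (algebraMap (HomogeneousLocalization.AtPrime
      (MvPolynomial.homogeneousSubmodule (Fin 3) k) (pointIdeal p))
      (Localization.AtPrime (pointIdeal p)))

/-- The multiplicity of `W` at `p`: the length of the local ring of `W` at `p`. -/
def multiplicity {k : Type*} [Field k] {n : ℕ} (W : PlaneSubscheme k n) (p : ℙ k (Fin 3 → k)) :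
    ℕ∞ :=
  Module.length
    (HomogeneousLocalization.AtPrime
      (MvPolynomial.homogeneousSubmodule (Fin 3) k) (pointIdeal p))
    (HomogeneousLocalization.AtPrime
      (MvPolynomial.homogeneousSubmodule (Fin 3) k) (pointIdeal p) ⧸ W.localIdeal p)

/-- The cycle `∑ mult_x(W) · x` of `W` is the zero-cycle `D`. -/
def HasCycle {k : Type*} [Field k] {n : ℕ} (W : PlaneSubscheme k n)
    (D : ℙ k (Fin 3 → k) →₀ ℕ) : Prop :=
  ∀ x, W.multiplicity x = (D x : ℕ∞)

/-- `W` is curvilinear, that is, contained in a smooth curve: some form `F` in the ideal of `W`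
defines a plane curve which is smooth at every point of `W`. (The smooth curve is the smooth locus
of `F = 0`.) -/
def IsCurvilinear {k : Type*} [Field k] {n : ℕ} (W : PlaneSubscheme k n) : Prop :=
  ∃ (d : ℕ) (F : MvPolynomial (Fin 3) k), F.IsHomogeneous d ∧ F ∈ W.ideal ∧
    ∀ x, W.HasPoint x → ∃ i, MvPolynomial.eval x.rep (MvPolynomial.pderiv i F) ≠ 0

/-- The projective tangent space `T_r W ⊆ ℙ²` of `W` at a point `r` of `W`: the common zeros of the
linear forms `∑ ∂ᵢf(r) xᵢ`, for `f` in the ideal of `W`. It is a line if `W` is curvilinear and not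
reduced at `r`. -/
def tangentSpace {k : Type*} [Field k] {n : ℕ} (W : PlaneSubscheme k n) (r : ℙ k (Fin 3 → k)) :
    Set (ℙ k (Fin 3 → k)) :=
  {x | ∀ f ∈ W.ideal,
    ∑ i, MvPolynomial.eval r.rep (MvPolynomial.pderiv i f) * x.rep i = 0}

end PlaneSubscheme

section Action

/-- The linear substitution `f ↦ f(g x)`. -/
def linearSubst {k : Type*} [Field k] (g : GL (Fin 3) k) :
    MvPolynomial (Fin 3) k →ₐ[k] MvPolynomial (Fin 3) k :=
  MvPolynomial.aeval (fun i => ∑ j, MvPolynomial.C (g.val i j) * MvPolynomial.X j)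

theorem linearSubst_X {k : Type*} [Field k] (g : GL (Fin 3) k) (i : Fin 3) :
    linearSubst g (MvPolynomial.X i) = ∑ j, MvPolynomial.C (g.val i j) * MvPolynomial.X j := by
  simp [linearSubst]

theorem linearSubst_C {k : Type*} [Field k] (g : GL (Fin 3) k) (a : k) :
    linearSubst g (MvPolynomial.C a) = MvPolynomial.C a := by
  simp [linearSubst]

theorem linearSubst_one {k : Type*} [Field k] :
    linearSubst (1 : GL (Fin 3) k) = AlgHom.id k _ := by
  apply MvPolynomial.algHom_ext
  intro i
  rw [linearSubst_X]
  simp [Matrix.one_apply]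

theorem linearSubst_mul {k : Type*} [Field k] (g h : GL (Fin 3) k) :
    linearSubst (g * h) = (linearSubst h).comp (linearSubst g) := by
  apply MvPolynomial.algHom_ext
  intro i
  rw [AlgHom.comp_apply, linearSubst_X, linearSubst_X, map_sum]
  simp only [map_mul, linearSubst_C, linearSubst_X, Units.val_mul, Matrix.mul_apply, map_sum,
    Finset.mul_sum, Finset.sum_mul]
  rw [Finset.sum_comm]
  simp only [mul_assoc]

theorem linearSubst_inv_apply {k : Type*} [Field k] (g : GL (Fin 3) k)
    (f : MvPolynomial (Fin 3) k) : linearSubst g (linearSubst g⁻¹ f) = f := by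
  rw [← AlgHom.comp_apply, ← linearSubst_mul, inv_mul_cancel, linearSubst_one, AlgHom.id_apply]

theorem linearSubst_isHomogeneous {k : Type*} [Field k] (g : GL (Fin 3) k) {d : ℕ}
    {f : MvPolynomial (Fin 3) k} (hf : f.IsHomogeneous d) : (linearSubst g f).IsHomogeneous d := by
  have h := hf.aeval (n := 1)
    (fun i => ∑ j, MvPolynomial.C (g.val i j) * MvPolynomial.X j) (fun i =>
      MvPolynomial.IsHomogeneous.sum _ _ _ fun j _ => by
        simpa using (MvPolynomial.isHomogeneous_C (Fin 3) (g.val i j)).mul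
          (MvPolynomial.isHomogeneous_X k j))
  simpa [linearSubst] using h

theorem linearSubst_homogeneousComponent {k : Type*} [Field k] (g : GL (Fin 3) k) (d : ℕ)
    (f : MvPolynomial (Fin 3) k) :
    linearSubst g (MvPolynomial.homogeneousComponent d f) =
      MvPolynomial.homogeneousComponent d (linearSubst g f) := by
  conv_rhs => rw [← MvPolynomial.sum_homogeneousComponent f]
  rw [map_sum, map_sum]
  have h : ∀ i, MvPolynomial.homogeneousComponent d
      (linearSubst g (MvPolynomial.homogeneousComponent i f)) =
      if i = d then linearSubst g (MvPolynomial.homogeneousComponent i f) else 0 := fun i => by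
    rw [MvPolynomial.homogeneousComponent_of_mem (linearSubst_isHomogeneous g
      (MvPolynomial.homogeneousComponent_isHomogeneous i f))]
    simp [eq_comm]
  simp only [h]
  rw [Finset.sum_ite_eq']
  split_ifs with hd
  · rfl
  · rw [MvPolynomial.homogeneousComponent_eq_zero _ _ (by simpa using hd), map_zero]

/-- Linear substitution on the space of forms of degree `d`. -/
def linearSubstEquiv {k : Type*} [Field k] (g : GL (Fin 3) k) (d : ℕ) :
    MvPolynomial.homogeneousSubmodule (Fin 3) k d ≃ₗ[k]
      MvPolynomial.homogeneousSubmodule (Fin 3) k d where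
  toFun f := ⟨linearSubst g f.1, linearSubst_isHomogeneous g f.2⟩
  invFun f := ⟨linearSubst g⁻¹ f.1, linearSubst_isHomogeneous g⁻¹ f.2⟩
  map_add' f f' := by ext1; simp
  map_smul' c f := by ext1; simp
  left_inv f := by
    ext1
    simpa using linearSubst_inv_apply g⁻¹ f.1
  right_inv f := by
    ext1
    simpa using linearSubst_inv_apply g f.1

/-- The action of `GL₃` on subschemes of `ℙ²` by linear change of coordinates: a polynomial `f`
vanishes on `g • W` if and only if `f(g x)` vanishes on `W`. -/
instance {k : Type*} [Field k] {n : ℕ} : SMul (GL (Fin 3) k) (PlaneSubscheme k n) where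
  smul g W :=
    { ideal := W.ideal.comap (linearSubst g)
      homogeneous := by
        intro d f hf
        have h := W.homogeneous d hf
        erw [MvPolynomial.decomposition.decompose'_apply] at h ⊢
        rw [Ideal.mem_comap, linearSubst_homogeneousComponent]
        exact h
      saturated := by
        intro f hf
        rw [Ideal.mem_comap]
        apply W.saturated
        intro i
        have key : (MvPolynomial.X i : MvPolynomial (Fin 3) k) * linearSubst g f =
            ∑ j, MvPolynomial.C (g⁻¹.val i j) * linearSubst g (MvPolynomial.X j * f) := by
          conv_lhs => rw [← linearSubst_inv_apply g (MvPolynomial.X i), linearSubst_X]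
          simp only [map_sum, map_mul, linearSubst_C, Finset.sum_mul, mul_assoc]
        rw [key]
        exact Ideal.sum_mem _ fun j _ => Ideal.mul_mem_left _ _ (hf j)
      length_eq := by
        filter_upwards [W.length_eq] with d hd
        refine Eq.trans
          (LinearEquiv.finrank_eq (Submodule.Quotient.equiv _ _ (linearSubstEquiv g d) ?_)) hd
        ext f
        rw [Submodule.mem_map_equiv]
        change linearSubst g (linearSubst g⁻¹ f.1) ∈ W.ideal ↔ f.1 ∈ W.ideal
        rw [linearSubst_inv_apply] }

theorem mem_smul_ideal {k : Type*} [Field k] {n : ℕ} (g : GL (Fin 3) k) (W : PlaneSubscheme k n)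
    (f : MvPolynomial (Fin 3) k) : f ∈ (g • W).ideal ↔ linearSubst g f ∈ W.ideal := Iff.rfl

instance {k : Type*} [Field k] {n : ℕ} : MulAction (GL (Fin 3) k) (PlaneSubscheme k n) where
  one_smul W := by
    apply PlaneSubscheme.ext
    ext f
    rw [mem_smul_ideal, linearSubst_one, AlgHom.id_apply]
  mul_smul g h W := by
    apply PlaneSubscheme.ext
    ext f
    rw [mem_smul_ideal, mem_smul_ideal, mem_smul_ideal, linearSubst_mul, AlgHom.comp_apply]

theorem scalar_smul_planeSubscheme {k : Type*} [Field k] {n : ℕ} (u : kˣ)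
    (W : PlaneSubscheme k n) : Matrix.GeneralLinearGroup.scalar (Fin 3) u • W = W := by
  have hX : ∀ (d : ℕ) (f : MvPolynomial (Fin 3) k), f.IsHomogeneous d →
      linearSubst (Matrix.GeneralLinearGroup.scalar (Fin 3) u) f =
        MvPolynomial.C ((u : k) ^ d) * f := by
    intro d f hf
    have h1 : linearSubst (Matrix.GeneralLinearGroup.scalar (Fin 3) u) =
        MvPolynomial.aeval (fun i => MvPolynomial.C (u : k) * MvPolynomial.X i) := by
      apply MvPolynomial.algHom_ext
      intro i
      rw [linearSubst_X]
      simp [Matrix.diagonal_apply, apply_ite MvPolynomial.C]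
    rw [h1, MvPolynomial.aeval_def, MvPolynomial.eval₂_eq]
    conv_rhs => rw [f.as_sum]
    rw [Finset.mul_sum]
    refine Finset.sum_congr rfl fun m hm => ?_
    have hdeg : ∑ i ∈ m.support, m i = d := by
      have := hf (MvPolynomial.mem_support_iff.mp hm)
      simpa [Finsupp.weight_apply, Finsupp.sum] using this
    rw [MvPolynomial.monomial_eq]
    simp only [mul_pow, Finset.prod_mul_distrib, Finset.prod_pow_eq_pow_sum, hdeg,
      MvPolynomial.algebraMap_eq, Finsupp.prod, map_pow]
    ring
  have hcomp : ∀ (V : PlaneSubscheme k n) (f), f ∈ V.ideal ↔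
      ∀ d, MvPolynomial.homogeneousComponent d f ∈ V.ideal := by
    intro V f
    constructor
    · intro hf d
      have h := V.homogeneous d hf
      erw [MvPolynomial.decomposition.decompose'_apply] at h
      exact h
    · intro hf
      rw [← MvPolynomial.sum_homogeneousComponent f]
      exact Ideal.sum_mem _ fun d _ => hf d
  apply PlaneSubscheme.ext
  ext f
  rw [hcomp, hcomp W]
  refine forall_congr' fun d => ?_
  rw [mem_smul_ideal, hX d _ (MvPolynomial.homogeneousComponent_isHomogeneous d f)]
  refine Ideal.unit_mul_mem_iff_mem _ ?_
  exact (u.isUnit.pow d).map MvPolynomial.C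

/-- The action of `PGL₃` on subschemes of `ℙ²`. -/
instance {k : Type*} [Field k] {n : ℕ} : MulAction PGL(3, k) (PlaneSubscheme k n) :=
  Matrix.ProjGenLinGroup.mulActionOfGL scalar_smul_planeSubscheme

end Action

namespace PlaneSubscheme

/-- A presentation of the `n`-th Hilbert point of a length `n` subscheme `W` with ideal `I`:
a surjection `k[x₀, x₁, x₂]ₙ → kⁿ` with kernel `Iₙ`. -/
structure HilbertFrame (k : Type*) [Field k] (n : ℕ) where
  /-- the subscheme -/
  scheme : PlaneSubscheme k n
  /-- the surjection -/
  map : MvPolynomial.homogeneousSubmodule (Fin 3) k n →ₗ[k] (Fin n → k)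
  surjective : Function.Surjective map
  ker_eq : LinearMap.ker map = degreePart scheme.ideal n

/-- The entries of the matrix of the surjection, with respect to the monomials of degree `n`. -/
def HilbertFrame.coords {k : Type*} [Field k] {n : ℕ} (M : HilbertFrame k n) :
    Fin n × {m : Fin 3 →₀ ℕ // m.degree = n} → k :=
  fun im => M.map ⟨MvPolynomial.monomial im.2.1 1,
    MvPolynomial.isHomogeneous_monomial 1 im.2.2⟩ im.1

/-- The Zariski topology on the set of `k`-points of the Hilbert scheme of `n` points in `ℙ²`.

The Hilbert scheme is a closed subscheme of the Grassmannian of `n`-dimensional quotients of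
`k[x₀, x₁, x₂]ₙ`, by sending `W` with ideal `I` to the quotient by `Iₙ` (`n` is the Gotzmann number
of the constant Hilbert polynomial `n`), and the Zariski topology on that Grassmannian is the
quotient topology from the space of matrices of rank `n`, on which the topology is induced from the
Zariski topology of affine space (the one induced by the map that sends a point to its maximal
ideal). -/
instance {k : Type*} [Field k] {n : ℕ} : TopologicalSpace (PlaneSubscheme k n) :=
  TopologicalSpace.coinduced HilbertFrame.scheme
    (TopologicalSpace.induced
      (fun M : HilbertFrame k n => MvPolynomial.pointToPoint (k := k) M.coords) inferInstance)

end PlaneSubscheme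

/-- `x` is a star point of the six points `z`: it is none of them, and for some ordering of them the
lines `z₁z₂`, `z₃z₄`, `z₅z₆` pass through `x`. -/
def IsStarPoint {k : Type*} [Field k] (z : Fin 6 → ℙ k (Fin 3 → k)) (x : ℙ k (Fin 3 → k)) : Prop :=
  (∀ i, x ≠ z i) ∧ ∃ σ : Equiv.Perm (Fin 6),
    Projectivization.Dependent ![x, z (σ 0), z (σ 1)] ∧
    Projectivization.Dependent ![x, z (σ 2), z (σ 3)] ∧
    Projectivization.Dependent ![x, z (σ 4), z (σ 5)]

/-- `Z` is (the reduced subscheme of `ℙ²` consisting of) six distinct points, no three of them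
collinear, without star points. -/
def PlaneSubscheme.IsStarFree {k : Type*} [Field k] (Z : PlaneSubscheme k 6) : Prop :=
  ∃ z : Fin 6 → ℙ k (Fin 3 → k), Function.Injective z ∧
    Z.ideal = ⨅ i, pointIdeal (z i) ∧
    (∀ i j l, i ≠ j → i ≠ l → j ≠ l → Projectivization.Independent ![z i, z j, z l]) ∧
    ∀ x, ¬ IsStarPoint z x

end

/-!
The two parts are the cases `p ≠ q` and `p = q` of one statement: a subscheme `W` with cycle
`p + q + 4r`, where `r` is different from `p` and `q`, whose tangent space at `r` contains neither `p` nor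
`q`, is not a limit of projective transforms of six points `z j`, no three of them collinear.

Suppose that it is. The equations of the orbit hold at the Hilbert point of `W`, so a valuation ring
`V` dominating the specialization of the generic frame to that of `W` gives a matrix `G` over the
fraction field `K` of `V` such that `W` is the limit of the six moving points `G z j`
(`exists_frame_of_mem_closure`, `exists_valuation_family`). Thus sextics containing `W` lift to
sextics through the moving points, and sextics through the moving points reduce to sextics
containing `W` (`LimitFamily.exists_lift`, `LimitFamily.mem_ideal_of_lift`). Applied to products of
linear forms, this shows that each moving point has a limit over `k`
(`LimitFamily.exists_isLimitPoint`), and that at least three of the limits are `r` and two are `p`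
or `q` (`HasQuadruplePoint.exists_indices`).

The tangency hypothesis gives a form in the ideal of `W` whose gradient at `r` vanishes neither at
`p` nor at `q`. Cutting it off at order four at `r` and multiplying by lines through `p` and `q`
yields a sextic with the same tangent line (`HasQuadruplePoint.exists_sextic`); let `P` be a lift of
it to a sextic through the moving points. Choose coordinates with `r = [1, 0, 0]`, tangent line
`x₂ = 0` and `p = [0, 0, 1]`, and let `g₀, g₁, g₂` be the rows of `G` in these coordinates. The
contradiction (`no_degeneration`) is a comparison of sizes. As the points whose limit is `r` span,
`g₁` and `g₂` are smaller than `g₀`. Hence the reduction of `g₀` (as a primitive form) vanishes at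
the two points whose limits are `p` or `q`, so at none of the other four. Subtract small multiples
of `g₀` to get `u₁` and `u₂` without a component along a fixed coordinate in which `g₀` is largest.
Since the four points lie on `P = 0`, whose reduction is tangent to `x₂ = 0` at `r`, the differences
of `u₂ / g₀` between them are smaller than those of `u₁ / g₀`. If `u₂` were at least as large as
`u₁`, the reduction of `u₂ / g₀` would be constant on three spanning points, which is absurd. So
`u₂` is smaller than `u₁`. But at the two remaining points `u₁` is at most as large as `u₂`, so the
reduction of `u₁` vanishes there, as does that of `g₀`. These two forms being independent, the two
points coincide, a contradiction.
-/

noncomputable section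

attribute [local instance] MvPolynomial.gradedAlgebra

/-! ### Valuations of linear forms -/

section Valuation

variable {K : Type*} [Field K] (V : ValuationSubring K)

/-- A nonzero vector over the field of fractions of a valuation ring is a multiple of a primitive
vector. -/
theorem exists_primitive_vector (v : Fin 3 → K) (hv : v ≠ 0) :
    ∃ (c : K) (w : Fin 3 → V) (i : Fin 3), c ≠ 0 ∧ w i = 1 ∧ ∀ l, v l = c * w l := by
  obtain ⟨i, -, hi⟩ := Finset.exists_max_image Finset.univ (fun l => V.valuation (v l))
    Finset.univ_nonempty
  have hvi : v i ≠ 0 := by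
    intro h
    apply hv
    ext l
    have := hi l (Finset.mem_univ l)
    simpa [h] using this
  have hmem : ∀ l, v l / v i ∈ V := by
    intro l
    rw [← V.valuation_le_one_iff, map_div₀]
    exact div_le_one_of_le₀ (hi l (Finset.mem_univ l)) zero_le
  refine ⟨v i, fun l => ⟨v l / v i, hmem l⟩, i, hvi, ?_, ?_⟩
  · ext1
    simp [hvi]
  · intro l
    field_simp

variable {V}

theorem residue_eq_zero_of_valuation_lt {c : K} {a : V}
    (h : V.valuation (c * a) < V.valuation c) : IsLocalRing.residue V a = 0 := by
  rw [IsLocalRing.residue_eq_zero_iff, V.valuation_lt_one_iff]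
  by_contra hc
  push Not at hc
  rw [map_mul] at h
  exact absurd (le_mul_of_one_le_right' hc) (not_le.mpr h)

theorem valuation_mul_le (c : K) (a : V) : V.valuation (c * a) ≤ V.valuation c := by
  rw [map_mul]
  exact mul_le_of_le_one_right' (V.valuation_le_one a)

theorem valuation_eq_one_of_residue_ne_zero {a : V} (h : IsLocalRing.residue V a ≠ 0) :
    V.valuation (a : K) = 1 := by
  rw [← V.valuation_eq_one_iff]
  by_contra hc
  exact h ((IsLocalRing.residue_eq_zero_iff a).mpr hc)

theorem dotProduct_scaled {u : Fin 3 → K} {c : K} {w : Fin 3 → V} (h : ∀ l, u l = c * w l)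
    (z : Fin 3 → V) : (u ⬝ᵥ fun l => (z l : K)) = c * ((w ⬝ᵥ z : V) : K) := by
  simp [dotProduct, h, Finset.mul_sum, mul_assoc]

theorem residue_dotProduct (w z : Fin 3 → V) :
    IsLocalRing.residue V (w ⬝ᵥ z) =
      (fun l => IsLocalRing.residue V (w l)) ⬝ᵥ (fun l => IsLocalRing.residue V (z l)) := by
  simp [dotProduct]

end Valuation

/-- The difference of the values of a polynomial at two points with the same reduction `x₀` is a
combination of the differences of the coordinates, whose coefficients reduce to the partial
derivatives at `x₀`. -/
theorem exists_divided_differences {A κ : Type*} [CommRing A] [CommRing κ] (φ : A →+* κ)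
    {σ : Type*} [Fintype σ] [DecidableEq σ] (P : MvPolynomial σ A) (x y : σ → A) (x₀ : σ → κ)
    (hx : ∀ i, φ (x i) = x₀ i) (hy : ∀ i, φ (y i) = x₀ i) :
    ∃ c : σ → A, (∀ i, φ (c i) = MvPolynomial.eval x₀
        (MvPolynomial.pderiv i (MvPolynomial.map φ P))) ∧
      MvPolynomial.eval x P - MvPolynomial.eval y P = ∑ i, c i * (x i - y i) := by
  induction P using MvPolynomial.induction_on with
  | C a => exact ⟨0, by simp, by simp⟩
  | add P Q hP hQ =>
    obtain ⟨c, hc, hc'⟩ := hP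
    obtain ⟨d, hd, hd'⟩ := hQ
    refine ⟨c + d, fun i => by simp [hc, hd], ?_⟩
    simp only [map_add, Pi.add_apply, add_mul, Finset.sum_add_distrib, ← hc', ← hd']
    ring
  | mul_X P n hP =>
    obtain ⟨c, hc, hc'⟩ := hP
    refine ⟨fun i => c i * x n + if i = n then MvPolynomial.eval y P else 0, fun i => ?_, ?_⟩
    · have h : φ (MvPolynomial.eval y P) = MvPolynomial.eval x₀ (MvPolynomial.map φ P) := by
        rw [MvPolynomial.eval_map, ← funext hy]
        exact MvPolynomial.hom_eval₂ P (RingHom.id A) φ y |>.trans (by simp)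
      by_cases hin : i = n
      · subst hin
        simp [hc, hx, h, mul_comm, add_comm]
      · simp [hc, hx, hin, MvPolynomial.pderiv_X_of_ne (Ne.symm hin), mul_comm]
    · have h1 : ∀ i, (c i * x n + if i = n then MvPolynomial.eval y P else 0) * (x i - y i) =
        c i * (x i - y i) * x n +
          if i = n then MvPolynomial.eval y P * (x i - y i) else 0 := by
        intro i
        split_ifs <;> ring
      simp only [h1, Finset.sum_add_distrib, ← Finset.sum_mul, ← hc']
      simp
      ring

theorem eval₂_scaled_of_isHomogeneous {A B : Type*} [CommRing A] [CommRing B] (φ : A →+* B)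
    {σ : Type*} {P : MvPolynomial σ A} {d : ℕ} (hP : P.IsHomogeneous d) (c : B) (x : σ → B) :
    MvPolynomial.eval₂ φ (fun i => c * x i) P = c ^ d * MvPolynomial.eval₂ φ x P := by
  rw [MvPolynomial.eval₂_eq, MvPolynomial.eval₂_eq, Finset.mul_sum]
  refine Finset.sum_congr rfl fun m hm => ?_
  have hdeg : ∑ i ∈ m.support, m i = d := by
    have := hP (MvPolynomial.mem_support_iff.mp hm)
    simpa [Finsupp.weight_apply, Finsupp.sum] using this
  simp only [mul_pow, Finset.prod_mul_distrib, Finset.prod_pow_eq_pow_sum, hdeg]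
  ring

/-! ### Degenerations of six points in general position -/

section Degeneration

variable {K : Type*} [Field K] {V : ValuationSubring K}

/-- If some coordinate of `u` has at least the size of the scalar `c`, then `u` cannot be smaller
than `c` at three points whose reductions span. -/
theorem valuation_lt_of_three_points {u : Fin 3 → K} {c : K} (hc : c ≠ 0) {z : Fin 6 → Fin 3 → V}
    {s : Fin 3 → Fin 6}
    (hz : ∀ w : Fin 3 → IsLocalRing.ResidueField V,
      (∀ i, w ⬝ᵥ (fun l => IsLocalRing.residue V (z (s i) l)) = 0) → w = 0)
    (hu : ∀ i, V.valuation (u ⬝ᵥ fun l => (z (s i) l : K)) < V.valuation c) (l : Fin 3) :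
    V.valuation (u l) < V.valuation c := by
  by_contra hl
  push Not at hl
  have hu0 : u ≠ 0 := by
    rintro rfl
    simp [hc] at hl
  obtain ⟨b, w, i₁, hb, hw, huw⟩ := exists_primitive_vector V u hu0
  have hcb : V.valuation c ≤ V.valuation b := by
    refine hl.trans ?_
    rw [huw l]
    exact valuation_mul_le b (w l)
  have hzero := hz (fun l => IsLocalRing.residue V (w l)) fun i => by
    rw [← residue_dotProduct]
    apply residue_eq_zero_of_valuation_lt (c := b)
    rw [← dotProduct_scaled huw]
    exact (hu i).trans_le hcb
  have := congrFun hzero i₁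
  simp [hw] at this

theorem injective_vec3 {α : Type*} {x y w : α} (hxy : x ≠ y) (hxw : x ≠ w) (hyw : y ≠ w) :
    Function.Injective ![x, y, w] := by
  intro i j h
  fin_cases i <;> fin_cases j <;>
    first
    | rfl
    | exact absurd h hxy
    | exact absurd h hxw
    | exact absurd h hyw
    | exact absurd h.symm hxy
    | exact absurd h.symm hxw
    | exact absurd h.symm hyw

theorem exists_three_of_ne (a b : Fin 6) :
    ∃ s : Fin 3 → Fin 6, Function.Injective s ∧ ∀ i, s i ≠ a ∧ s i ≠ b := by
  have : 3 ≤ ((Finset.univ.erase a).erase b).card := by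
    have h1 := Finset.pred_card_le_card_erase (s := Finset.univ.erase a) (a := b)
    rw [Finset.card_erase_of_mem (Finset.mem_univ a), Finset.card_univ, Fintype.card_fin] at h1
    omega
  obtain ⟨t, ht, htc⟩ := Finset.exists_subset_card_eq this
  refine ⟨t.orderEmbOfFin htc, (t.orderEmbOfFin htc).injective, fun i => ?_⟩
  have := ht (t.orderEmbOfFin_mem htc i)
  simp at this
  exact ⟨this.2, this.1⟩

/-- Six points whose reductions are in linearly general position, moved by a matrix with rows
`g 0`, `g 1`, `g 2` over the field of a valuation ring. It is impossible that three of the moved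
points reduce to `[1, 0, 0]`, that the reduction of two others lies off the line `x₂ = 0`, and
that the moved points lie on a curve whose reduction is smooth at `[1, 0, 0]` with tangent line
`x₂ = 0`.

The sizes of the rows are compared after clearing a leading coordinate of `g 0` from the others. -/
theorem no_degeneration (z : Fin 6 → Fin 3 → V)
    (hz : ∀ s : Fin 3 → Fin 6, Function.Injective s →
      ∀ w : Fin 3 → IsLocalRing.ResidueField V,
      (∀ i, w ⬝ᵥ (fun l => IsLocalRing.residue V (z (s i) l)) = 0) → w = 0)
    (g : Fin 3 → Fin 3 → K) {d : ℕ} (P : MvPolynomial (Fin 3) V) (hP : P.IsHomogeneous d)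
    (hPz : ∀ j, MvPolynomial.aeval (fun i => g i ⬝ᵥ fun l => (z j l : K)) P = 0)
    (h1 : MvPolynomial.eval ![1, 0, 0]
      (MvPolynomial.pderiv 1 (MvPolynomial.map (IsLocalRing.residue V) P)) = 0)
    (h2 : MvPolynomial.eval ![1, 0, 0]
      (MvPolynomial.pderiv 2 (MvPolynomial.map (IsLocalRing.residue V) P)) ≠ 0)
    (s : Fin 3 → Fin 6) (hs : Function.Injective s)
    (hs1 : ∀ i, V.valuation (g 1 ⬝ᵥ fun l => (z (s i) l : K)) <
      V.valuation (g 0 ⬝ᵥ fun l => (z (s i) l : K)))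
    (hs2 : ∀ i, V.valuation (g 2 ⬝ᵥ fun l => (z (s i) l : K)) <
      V.valuation (g 0 ⬝ᵥ fun l => (z (s i) l : K)))
    (t : Fin 2 → Fin 6) (ht : Function.Injective t)
    (ht0 : ∀ i, V.valuation (g 0 ⬝ᵥ fun l => (z (t i) l : K)) ≤
      V.valuation (g 2 ⬝ᵥ fun l => (z (t i) l : K)))
    (ht1 : ∀ i, V.valuation (g 1 ⬝ᵥ fun l => (z (t i) l : K)) ≤
      V.valuation (g 2 ⬝ᵥ fun l => (z (t i) l : K)))
    (ht2 : ∀ i, (g 2 ⬝ᵥ fun l => (z (t i) l : K)) ≠ 0) : False := by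
  set ρ := IsLocalRing.residue V with hρ
  have hg0 : g 0 ≠ 0 := by
    intro h
    have := hs1 0
    simp [h] at this
  obtain ⟨c, γ, i₀, hc, hγ, hgγ⟩ := exists_primitive_vector V (g 0) hg0
  have hy0 : ∀ j, (g 0 ⬝ᵥ fun l => (z j l : K)) = c * ((γ ⬝ᵥ z j : V) : K) :=
    fun j => dotProduct_scaled hgγ (z j)
  -- The rows `g 1` and `g 2` are smaller than `g 0`.
  have hle0 : ∀ j, V.valuation (g 0 ⬝ᵥ fun l => (z j l : K)) ≤ V.valuation c := fun j => by
    rw [hy0]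
    exact valuation_mul_le c _
  have hlt1 : ∀ l, V.valuation (g 1 l) < V.valuation c :=
    valuation_lt_of_three_points hc (hz s hs) fun i => (hs1 i).trans_le (hle0 _)
  have hlt2 : ∀ l, V.valuation (g 2 l) < V.valuation c :=
    valuation_lt_of_three_points hc (hz s hs) fun i => (hs2 i).trans_le (hle0 _)
  have hlt : ∀ u : Fin 3 → K, (∀ l, V.valuation (u l) < V.valuation c) → ∀ j,
      V.valuation (u ⬝ᵥ fun l => (z j l : K)) < V.valuation c := by
    intro u hu j
    refine Valuation.map_sum_lt _ ((map_ne_zero _).mpr hc) fun l _ => ?_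
    rw [map_mul]
    exact (mul_le_of_le_one_right' (V.valuation_le_one _)).trans_lt (hu l)
  -- The points that do not reduce to `[1, 0, 0]` are those at which `γ` reduces to zero.
  have hta : ∀ i, ρ (γ ⬝ᵥ z (t i)) = 0 := fun i => by
    apply residue_eq_zero_of_valuation_lt (c := c)
    rw [← hy0]
    exact (ht0 i).trans_lt (hlt _ hlt2 _)
  have htU : ∀ j, j ≠ t 0 → j ≠ t 1 → ρ (γ ⬝ᵥ z j) ≠ 0 := by
    intro j hj0 hj1 hj
    have hinj : Function.Injective ![t 0, t 1, j] :=
      injective_vec3 (fun h => absurd (ht h) (by decide)) hj0.symm hj1.symm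
    have := hz _ hinj (fun l => ρ (γ l)) fun i => by
      rw [← residue_dotProduct]
      fin_cases i
      · exact hta 0
      · exact hta 1
      · exact hj
    have := congrFun this i₀
    simp [hγ] at this
  have hv0 : ∀ j, j ≠ t 0 → j ≠ t 1 →
      V.valuation (g 0 ⬝ᵥ fun l => (z j l : K)) = V.valuation c := by
    intro j hj0 hj1
    rw [hy0, map_mul, valuation_eq_one_of_residue_ne_zero (htU j hj0 hj1), mul_one]
  obtain ⟨r, hr, hrt⟩ := exists_three_of_ne (t 0) (t 1)
  -- Clear the coordinate `i₀` from `g 1` and `g 2`.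
  have hmu : ∀ e : Fin 3, (∀ l, V.valuation (g e l) < V.valuation c) →
      V.valuation (g e i₀ / c) < 1 := by
    intro e he
    rw [map_div₀]
    exact (div_lt_one₀ (zero_lt_iff.mpr ((map_ne_zero _).mpr hc))).mpr (he i₀)
  have hg0i : g 0 i₀ = c := by simp [hgγ, hγ]
  let u : Fin 3 → Fin 3 → K := fun e l => g e l - g e i₀ / c * g 0 l
  have hui : ∀ e, u e i₀ = 0 := fun e => by
    simp only [u, hg0i]
    field_simp
    ring
  have huz : ∀ e j, (u e ⬝ᵥ fun l => (z j l : K)) =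
      (g e ⬝ᵥ fun l => (z j l : K)) - g e i₀ / c * (g 0 ⬝ᵥ fun l => (z j l : K)) := by
    intro e j
    simp only [u, dotProduct, sub_mul, Finset.sum_sub_distrib, Finset.mul_sum, mul_assoc]
  -- Along the points reducing to `[1, 0, 0]` the second affine coordinate contracts the first.
  have hcontr : ∀ i j, ∃ ε : K, V.valuation ε < 1 ∧
      (u 2 ⬝ᵥ fun l => (z (r i) l : K)) / (g 0 ⬝ᵥ fun l => (z (r i) l : K)) -
      (u 2 ⬝ᵥ fun l => (z (r j) l : K)) / (g 0 ⬝ᵥ fun l => (z (r j) l : K)) =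
      ε * ((u 1 ⬝ᵥ fun l => (z (r i) l : K)) / (g 0 ⬝ᵥ fun l => (z (r i) l : K)) -
      (u 1 ⬝ᵥ fun l => (z (r j) l : K)) / (g 0 ⬝ᵥ fun l => (z (r j) l : K))) := by
    have hne : ∀ i, (g 0 ⬝ᵥ fun l => (z (r i) l : K)) ≠ 0 := fun i => by
      rw [← map_ne_zero V.valuation, hv0 _ (hrt i).1 (hrt i).2, map_ne_zero]
      exact hc
    have hm : ∀ e, (∀ l, V.valuation (g e l) < V.valuation c) → ∀ i, V.valuation
        ((g e ⬝ᵥ fun l => (z (r i) l : K)) / (g 0 ⬝ᵥ fun l => (z (r i) l : K))) < 1 := by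
      intro e he i
      rw [map_div₀, hv0 _ (hrt i).1 (hrt i).2]
      exact (div_lt_one₀ (zero_lt_iff.mpr ((map_ne_zero _).mpr hc))).mpr (hlt _ he _)
    let q : Fin 3 → Fin 3 → V := fun i => ![1, ⟨_, (V.valuation_le_one_iff _).mp (hm 1 hlt1 i).le⟩,
      ⟨_, (V.valuation_le_one_iff _).mp (hm 2 hlt2 i).le⟩]
    have hq : ∀ i e, (q i e : K) = (g 0 ⬝ᵥ fun l => (z (r i) l : K))⁻¹ *
        (g e ⬝ᵥ fun l => (z (r i) l : K)) := by
      intro i e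
      fin_cases e
      · simp [q, hne i]
      · simp [q, div_eq_inv_mul]
      · simp [q, div_eq_inv_mul]
    have hqρ : ∀ i e, ρ (q i e) = (![1, 0, 0] : Fin 3 → _) e := by
      intro i e
      fin_cases e
      · simp [q]
      · simp only [q, hρ]
        exact (IsLocalRing.residue_eq_zero_iff _).mpr
          ((V.valuation_lt_one_iff _).mpr (hm 1 hlt1 i))
      · simp only [q, hρ]
        exact (IsLocalRing.residue_eq_zero_iff _).mpr
          ((V.valuation_lt_one_iff _).mpr (hm 2 hlt2 i))
    have hPq : ∀ i, MvPolynomial.eval (q i) P = 0 := by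
      intro i
      apply Subtype.val_injective
      change algebraMap V K (MvPolynomial.eval (q i) P) = 0
      have h := MvPolynomial.hom_eval₂ P (RingHom.id V) (algebraMap V K) (q i)
      rw [RingHom.comp_id] at h
      refine h.trans ?_
      have h' : (fun e => algebraMap V K (q i e)) = fun e => (g 0 ⬝ᵥ fun l => (z (r i) l : K))⁻¹ *
          (g e ⬝ᵥ fun l => (z (r i) l : K)) := funext fun e => hq i e
      rw [h', eval₂_scaled_of_isHomogeneous _ hP]
      have h'' := hPz (r i)
      rw [MvPolynomial.aeval_def] at h''
      rw [h'', mul_zero]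
    intro i j
    obtain ⟨a, ha, hadd⟩ := exists_divided_differences ρ P (q i) (q j) _ (hqρ i) (hqρ j)
    rw [hPq, hPq, sub_zero, Fin.sum_univ_three] at hadd
    have ha2 : V.valuation (a 2 : K) = 1 := by
      apply valuation_eq_one_of_residue_ne_zero
      rw [← hρ, ha]
      exact h2
    have ha1 : V.valuation (a 1 : K) < 1 := by
      rw [← V.valuation_lt_one_iff, ← IsLocalRing.residue_eq_zero_iff, ← hρ, ha]
      exact h1
    have ha20 : (a 2 : K) ≠ 0 := by
      intro h
      simp [h] at ha2
    refine ⟨-(a 1 : K) / a 2, by rw [map_div₀, Valuation.map_neg, ha2, div_one]; exact ha1, ?_⟩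
    have hK := congrArg (Subtype.val) hadd
    push_cast at hK
    simp only [hq] at hK
    simp only [huz]
    have hnei := hne i
    have hnej := hne j
    field_simp at hK ⊢
    linear_combination (-c) * hK
  -- The row `u 2` is smaller than `u 1`.
  have hu2z : ∀ i, V.valuation (u 2 ⬝ᵥ fun l => (z (t i) l : K)) =
      V.valuation (g 2 ⬝ᵥ fun l => (z (t i) l : K)) := by
    intro i
    rw [huz]
    apply Valuation.map_sub_eq_of_lt_left
    rw [map_mul]
    exact (mul_le_mul' le_rfl (ht0 i)).trans_lt
      (mul_lt_of_lt_one_left (zero_lt_iff.mpr ((map_ne_zero _).mpr (ht2 i))) (hmu 2 hlt2))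
  have hu2 : u 2 ≠ 0 := by
    intro h
    have := hu2z 0
    rw [h, zero_dotProduct, map_zero] at this
    exact ht2 0 ((map_eq_zero _).mp this.symm)
  obtain ⟨c₂, γ₂, i₂, hc₂, hγ₂, hu₂⟩ := exists_primitive_vector V (u 2) hu2
  have hu2i : γ₂ i₀ = 0 := by
    have := hu₂ i₀
    rw [hui] at this
    simpa [hc₂] using this.symm
  have hbig : ∃ l, V.valuation c₂ < V.valuation (u 1 l) := by
    by_contra hall
    push Not at hall
    have hle : ∀ j, V.valuation (u 1 ⬝ᵥ fun l => (z j l : K)) ≤ V.valuation c₂ := by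
      intro j
      refine Valuation.map_sum_le _ fun l _ => ?_
      rw [map_mul]
      exact (mul_le_of_le_one_right' (V.valuation_le_one _)).trans (hall l)
    have hunit : ∀ i, IsUnit (γ ⬝ᵥ z (r i)) := fun i => by
      by_contra hn
      exact htU _ (hrt i).1 (hrt i).2 ((IsLocalRing.residue_eq_zero_iff _).mpr hn)
    have hres : ∀ i j, ρ (γ₂ ⬝ᵥ z (r i)) * ρ (γ ⬝ᵥ z (r j)) =
        ρ (γ₂ ⬝ᵥ z (r j)) * ρ (γ ⬝ᵥ z (r i)) := by
      intro i j
      obtain ⟨ε, hε, h⟩ := hcontr i j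
      rw [← sub_eq_zero, ← map_mul, ← map_mul, ← map_sub, hρ, IsLocalRing.residue_eq_zero_iff,
        V.valuation_lt_one_iff]
      simp only [hy0, dotProduct_scaled hu₂] at h
      have hi : V.valuation ((γ ⬝ᵥ z (r i) : V) : K) = 1 :=
        (V.valuation_eq_one_iff _).mp (hunit i)
      have hj : V.valuation ((γ ⬝ᵥ z (r j) : V) : K) = 1 :=
        (V.valuation_eq_one_iff _).mp (hunit j)
      have hi0 : ((γ ⬝ᵥ z (r i) : V) : K) ≠ 0 := fun h0 => by simp [h0] at hi
      have hj0 : ((γ ⬝ᵥ z (r j) : V) : K) ≠ 0 := fun h0 => by simp [h0] at hj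
      have hval : ((γ₂ ⬝ᵥ z (r i) * γ ⬝ᵥ z (r j) - γ₂ ⬝ᵥ z (r j) * γ ⬝ᵥ z (r i) : V) : K) =
          ε * (((u 1 ⬝ᵥ fun l => (z (r i) l : K)) * ((γ ⬝ᵥ z (r j) : V) : K) -
            (u 1 ⬝ᵥ fun l => (z (r j) l : K)) * ((γ ⬝ᵥ z (r i) : V) : K)) / c₂) := by
        push_cast
        field_simp at h ⊢
        linear_combination h
      rw [hval, map_mul]
      refine mul_lt_one_of_lt_of_le hε ?_
      rw [map_div₀]
      refine div_le_one_of_le₀ (V.valuation.map_sub_le ?_ ?_) zero_le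
      · rw [map_mul, hj, mul_one]
        exact hle _
      · rw [map_mul, hi, mul_one]
        exact hle _
    have hw := hz r hr
      (fun l => ρ (γ ⬝ᵥ z (r 0)) * ρ (γ₂ l) - ρ (γ₂ ⬝ᵥ z (r 0)) * ρ (γ l)) fun i => by
      have : (fun l => ρ (γ ⬝ᵥ z (r 0)) * ρ (γ₂ l) - ρ (γ₂ ⬝ᵥ z (r 0)) * ρ (γ l)) =
          ρ (γ ⬝ᵥ z (r 0)) • (fun l => ρ (γ₂ l)) - ρ (γ₂ ⬝ᵥ z (r 0)) • (fun l => ρ (γ l)) := by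
        ext l
        simp
      rw [this, sub_dotProduct, smul_dotProduct, smul_dotProduct, ← residue_dotProduct,
        ← residue_dotProduct, smul_eq_mul, smul_eq_mul]
      linear_combination hres i 0
    have hw0 := congrFun hw i₀
    simp only [hu2i, hγ, map_zero, mul_zero, map_one, mul_one, zero_sub, Pi.zero_apply,
      neg_eq_zero] at hw0
    have hw2 := congrFun hw i₂
    simp only [hw0, hγ₂, map_one, mul_one, zero_mul, sub_zero, Pi.zero_apply] at hw2
    exact htU _ (hrt 0).1 (hrt 0).2 hw2
  obtain ⟨l₁, hl₁⟩ := hbig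
  have hu1 : u 1 ≠ 0 := by
    intro h
    simp [h] at hl₁
  obtain ⟨c₁, γ₁, i₁, hc₁, hγ₁, hu₁⟩ := exists_primitive_vector V (u 1) hu1
  have hu1i : γ₁ i₀ = 0 := by
    have := hu₁ i₀
    rw [hui] at this
    simpa [hc₁] using this.symm
  -- Two independent forms reduce to zero at the two remaining points.
  have hta1 : ∀ i, ρ (γ₁ ⬝ᵥ z (t i)) = 0 := fun i => by
    apply residue_eq_zero_of_valuation_lt (c := c₁)
    rw [← dotProduct_scaled hu₁, huz]
    calc _ ≤ V.valuation (g 2 ⬝ᵥ fun l => (z (t i) l : K)) := by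
          refine V.valuation.map_sub_le (ht1 i) ?_
          rw [map_mul]
          exact (mul_le_of_le_one_left' (hmu 1 hlt1).le).trans (ht0 i)
      _ = V.valuation (u 2 ⬝ᵥ fun l => (z (t i) l : K)) := (hu2z i).symm
      _ ≤ V.valuation c₂ := by
          rw [dotProduct_scaled hu₂]
          exact valuation_mul_le _ _
      _ < V.valuation (u 1 l₁) := hl₁
      _ ≤ V.valuation c₁ := by
          rw [hu₁ l₁]
          exact valuation_mul_le _ _
  have hinj : Function.Injective ![t 0, t 1, r 0] :=
    injective_vec3 (fun h => absurd (ht h) (by decide)) (hrt 0).1.symm (hrt 0).2.symm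
  have hw := hz _ hinj
    (fun l => ρ (γ ⬝ᵥ z (r 0)) * ρ (γ₁ l) - ρ (γ₁ ⬝ᵥ z (r 0)) * ρ (γ l)) fun i => by
    have : (fun l => ρ (γ ⬝ᵥ z (r 0)) * ρ (γ₁ l) - ρ (γ₁ ⬝ᵥ z (r 0)) * ρ (γ l)) =
        ρ (γ ⬝ᵥ z (r 0)) • (fun l => ρ (γ₁ l)) - ρ (γ₁ ⬝ᵥ z (r 0)) • (fun l => ρ (γ l)) := by
      ext l
      simp
    rw [this, sub_dotProduct, smul_dotProduct, smul_dotProduct, ← residue_dotProduct,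
      ← residue_dotProduct, smul_eq_mul, smul_eq_mul]
    fin_cases i
    · exact (by rw [hta 0, hta1 0]; ring :
        ρ (γ ⬝ᵥ z (r 0)) * ρ (γ₁ ⬝ᵥ z (t 0)) - ρ (γ₁ ⬝ᵥ z (r 0)) * ρ (γ ⬝ᵥ z (t 0)) = 0)
    · exact (by rw [hta 1, hta1 1]; ring :
        ρ (γ ⬝ᵥ z (r 0)) * ρ (γ₁ ⬝ᵥ z (t 1)) - ρ (γ₁ ⬝ᵥ z (r 0)) * ρ (γ ⬝ᵥ z (t 1)) = 0)
    · exact (by ring :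
        ρ (γ ⬝ᵥ z (r 0)) * ρ (γ₁ ⬝ᵥ z (r 0)) - ρ (γ₁ ⬝ᵥ z (r 0)) * ρ (γ ⬝ᵥ z (r 0)) = 0)
  have hw0 := congrFun hw i₀
  simp only [hu1i, hγ, map_zero, mul_zero, map_one, mul_one, zero_sub, Pi.zero_apply,
    neg_eq_zero] at hw0
  have hw1 := congrFun hw i₁
  simp only [hw0, hγ₁, map_one, mul_one, zero_mul, sub_zero, Pi.zero_apply] at hw1
  exact htU _ (hrt 0).1 (hrt 0).2 hw1

end Degeneration

/-! ### Length in a local ring -/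

section Length

variable {R : Type*} [CommRing R] [IsLocalRing R]

open IsLocalRing in
/-- A quotient of length at most `n` of a local ring is killed by every product of `n` elements of
the maximal ideal: otherwise the partial products generate a chain of ideals that is too long. -/
theorem prod_mem_of_length_le {I : Ideal R} {n : ℕ} (h : Module.length R (R ⧸ I) ≤ n) (a : ℕ → R)
    (ha : ∀ i, a i ∈ maximalIdeal R) : ∏ i ∈ Finset.range n, a i ∈ I := by
  by_contra hn
  have hnot : ∀ i ≤ n, ∏ l ∈ Finset.range i, a l ∉ I := fun i hi hmem => hn <| by
    obtain ⟨c, hc⟩ := Finset.prod_dvd_prod_of_subset _ _ a (Finset.range_subset_range.mpr hi)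
    rw [hc]
    exact I.mul_mem_right _ hmem
  have key : ∀ i ≤ n, (i : ℕ∞) ≤
      Order.coheight (I ⊔ Ideal.span {∏ l ∈ Finset.range i, a l}) := by
    intro i
    induction i with
    | zero => simp
    | succ i ih =>
      intro hi
      have hlt : I ⊔ Ideal.span {∏ l ∈ Finset.range (i + 1), a l} <
          I ⊔ Ideal.span {∏ l ∈ Finset.range i, a l} := by
        refine lt_of_le_not_ge (sup_le_sup le_rfl ?_) fun hle => ?_
        · rw [Finset.prod_range_succ, Ideal.span_singleton_le_span_singleton]
          exact Dvd.intro _ rfl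
        · have hmem : ∏ l ∈ Finset.range i, a l ∈
              I ⊔ Ideal.span {∏ l ∈ Finset.range (i + 1), a l} :=
            hle (Ideal.mem_sup_right (Ideal.mem_span_singleton_self _))
          obtain ⟨x, hx, y, hy, hxy⟩ := Submodule.mem_sup.mp hmem
          obtain ⟨c, rfl⟩ := Ideal.mem_span_singleton'.mp hy
          have hu : IsUnit (1 - c * a i) :=
            isUnit_one_sub_self_of_mem_nonunits _ (by
              simpa [mem_maximalIdeal] using (maximalIdeal R).mul_mem_left c (ha i))
          refine hnot i (by omega) ((Ideal.unit_mul_mem_iff_mem I hu).mp ?_)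
          rw [Finset.prod_range_succ] at hxy
          convert hx using 1
          linear_combination -hxy
      calc ((i + 1 : ℕ) : ℕ∞) = i + 1 := by push_cast; rfl
        _ ≤ Order.coheight (I ⊔ Ideal.span {∏ l ∈ Finset.range i, a l}) + 1 := by
            gcongr
            exact ih (by omega)
        _ ≤ _ := Order.coheight_add_one_le hlt
  have hlt : I < I ⊔ Ideal.span {∏ l ∈ Finset.range n, a l} :=
    lt_of_le_not_ge le_sup_left fun hle =>
      hn (hle (Ideal.mem_sup_right (Ideal.mem_span_singleton_self _)))
  have h1 := Order.coheight_add_one_le hlt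
  rw [Module.length_quotient] at h
  have h2 : ((n + 1 : ℕ) : ℕ∞) ≤ n := by
    push_cast
    exact (add_le_add_left (key n le_rfl) 1).trans (h1.trans h)
  have h3 : n + 1 ≤ n := by exact_mod_cast h2
  omega

open IsLocalRing in
/-- If the maximal ideal is generated by `u` modulo `I`, and `I` contains `u ^ c`, then `R ⧸ I` has
length at most `c`. -/
theorem length_le_of_pow_mem {u : R} (c : ℕ) {I : Ideal R}
    (hu : maximalIdeal R ≤ I ⊔ Ideal.span {u}) (hc : u ^ c ∈ I) :
    Module.length R (R ⧸ I) ≤ c := by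
  induction c generalizing I with
  | zero =>
    have : I = ⊤ := (Ideal.eq_top_iff_one I).mpr (by simpa using hc)
    subst this
    rw [Module.length_quotient, Order.coheight_top]
    simp
  | succ c ih =>
    have hII : I ≤ I ⊔ Ideal.span {u ^ c} := le_sup_left
    have h1 := ih (I := I ⊔ Ideal.span {u ^ c})
      (hu.trans (sup_le_sup le_sup_left le_rfl))
      (Ideal.mem_sup_right (Ideal.mem_span_singleton_self _))
    let φ : R →ₗ[R] R ⧸ I := I.mkQ ∘ₗ LinearMap.toSpanSingleton R R (u ^ c)
    have hφ : ∀ x, φ x = I.mkQ (x * u ^ c) := fun x => rfl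
    have hker : maximalIdeal R ≤ LinearMap.ker φ := by
      intro y hy
      obtain ⟨i, hi, s, hs, rfl⟩ := Submodule.mem_sup.mp (hu hy)
      obtain ⟨d, rfl⟩ := Ideal.mem_span_singleton'.mp hs
      rw [LinearMap.mem_ker, hφ, Submodule.mkQ_apply, Submodule.Quotient.mk_eq_zero]
      have : (i + d * u) * u ^ c = i * u ^ c + d * u ^ (c + 1) := by ring
      rw [this]
      exact I.add_mem (I.mul_mem_right _ hi) (I.mul_mem_left _ hc)
    have hN : Module.length R (LinearMap.range φ) ≤ 1 := by
      have hsimple : IsSimpleModule R (R ⧸ maximalIdeal R) :=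
        isSimpleModule_iff_isCoatom.mpr (maximalIdeal.isMaximal R).out
      rw [← Module.length_eq_one R (R ⧸ maximalIdeal R)]
      refine Module.length_le_of_surjective
        ((maximalIdeal R).liftQ φ.rangeRestrict (by rwa [LinearMap.ker_rangeRestrict])) ?_
      rw [← LinearMap.range_eq_top, Submodule.range_liftQ, LinearMap.range_rangeRestrict]
    have hfac : ∀ y, Submodule.factor hII (I.mkQ y) =
        Submodule.Quotient.mk (p := I ⊔ Ideal.span {u ^ c}) y := fun _ => rfl
    have hexact : Function.Exact (LinearMap.range φ).subtype (Submodule.factor hII) := by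
      intro y
      obtain ⟨y, rfl⟩ := I.mkQ_surjective y
      constructor
      · intro hy
        rw [hfac, Submodule.Quotient.mk_eq_zero] at hy
        obtain ⟨i, hi, s, hs, rfl⟩ := Submodule.mem_sup.mp hy
        obtain ⟨d, rfl⟩ := Ideal.mem_span_singleton'.mp hs
        refine ⟨⟨φ d, d, rfl⟩, ?_⟩
        change I.mkQ (d * u ^ c) = I.mkQ (i + d * u ^ c)
        rw [Submodule.mkQ_apply, Submodule.mkQ_apply, Submodule.Quotient.eq]
        simpa using hi
      · rintro ⟨⟨_, d, rfl⟩, h⟩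
        rw [← h]
        change Submodule.factor hII (I.mkQ (d * u ^ c)) = 0
        rw [hfac, Submodule.Quotient.mk_eq_zero]
        exact Ideal.mem_sup_right (Ideal.mem_span_singleton'.mpr ⟨d, rfl⟩)
    rw [Module.length_eq_add_of_exact _ _ (Submodule.subtype_injective _)
      (Submodule.factor_surjective hII) hexact]
    push_cast
    rw [add_comm]
    exact add_le_add h1 hN

end Length

/-! ### Linear forms and coordinates -/

section LinearForms

/-- The linear form with coefficient vector `a`. -/
def linForm {A : Type*} [CommRing A] (a : Fin 3 → A) : MvPolynomial (Fin 3) A :=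
  ∑ i, MvPolynomial.C (a i) * MvPolynomial.X i

theorem linForm_isHomogeneous {A : Type*} [CommRing A] (a : Fin 3 → A) :
    (linForm a).IsHomogeneous 1 :=
  MvPolynomial.IsHomogeneous.sum _ _ _ fun i _ => MvPolynomial.isHomogeneous_C_mul_X (a i) i

theorem eval₂_linForm {A B : Type*} [CommRing A] [CommRing B] (φ : A →+* B) (a : Fin 3 → A)
    (v : Fin 3 → B) : MvPolynomial.eval₂ φ v (linForm a) = (fun i => φ (a i)) ⬝ᵥ v := by
  simp [linForm, dotProduct, MvPolynomial.eval₂_sum]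

theorem eval_linForm {A : Type*} [CommRing A] (a v : Fin 3 → A) :
    MvPolynomial.eval v (linForm a) = a ⬝ᵥ v := by
  simp [linForm, dotProduct]

theorem map_linForm {A B : Type*} [CommRing A] [CommRing B] (φ : A →+* B) (a : Fin 3 → A) :
    MvPolynomial.map φ (linForm a) = linForm fun i => φ (a i) := by
  simp [linForm]

variable {k : Type*} [Field k]

theorem linearSubst_X_eq_linForm (g : GL (Fin 3) k) (i : Fin 3) :
    linearSubst g (MvPolynomial.X i) = linForm (g.val i) :=
  linearSubst_X g i

theorem aeval_linearSubst {B : Type*} [CommRing B] [Algebra k B] (g : GL (Fin 3) k)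
    (f : MvPolynomial (Fin 3) k) (v : Fin 3 → B) :
    MvPolynomial.aeval v (linearSubst g f) =
      MvPolynomial.aeval (fun i => ∑ j, algebraMap k B (g.val i j) * v j) f := by
  rw [linearSubst, ← AlgHom.comp_apply, MvPolynomial.comp_aeval]
  simp

theorem eval_linearSubst (g : GL (Fin 3) k) (f : MvPolynomial (Fin 3) k) (v : Fin 3 → k) :
    MvPolynomial.eval v (linearSubst g f) = MvPolynomial.eval (g.val.mulVec v) f :=
  aeval_linearSubst g f v

/-- Chain rule for a linear substitution. -/
theorem eval_pderiv_linearSubst (g : GL (Fin 3) k) (f : MvPolynomial (Fin 3) k) (v : Fin 3 → k)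
    (j : Fin 3) :
    MvPolynomial.eval v (MvPolynomial.pderiv j (linearSubst g f)) =
      ∑ i, MvPolynomial.eval (g.val.mulVec v) (MvPolynomial.pderiv i f) * g.val i j := by
  induction f using MvPolynomial.induction_on with
  | C a => simp
  | add p q hp hq => simp [hp, hq, add_mul, Finset.sum_add_distrib]
  | mul_X p n hp =>
    have h1 : MvPolynomial.eval v (MvPolynomial.pderiv j (linearSubst g (MvPolynomial.X n))) =
        g.val n j := by
      rw [linearSubst_X, map_sum, map_sum, Finset.sum_eq_single j]
      · simp
      · intro l _ hl
        simp [MvPolynomial.pderiv_X_of_ne hl]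
      · simp
    have h2 : ∀ i, MvPolynomial.eval (g.val.mulVec v)
        (MvPolynomial.pderiv i (MvPolynomial.X n : MvPolynomial (Fin 3) k)) * g.val i j =
        if i = n then g.val n j else 0 := by
      intro i
      split_ifs with h
      · subst h
        simp
      · simp [MvPolynomial.pderiv_X_of_ne (Ne.symm h)]
    have h3 : MvPolynomial.eval v (linearSubst g (MvPolynomial.X n)) = g.val.mulVec v n := by
      rw [eval_linearSubst, MvPolynomial.eval_X]
    simp only [map_mul, Derivation.leibniz, smul_eq_mul, map_add, add_mul,
      Finset.sum_add_distrib, hp, h1, h3, eval_linearSubst g p, mul_assoc, h2, ← Finset.mul_sum,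
      MvPolynomial.eval_X]
    simp

/-- Projective coordinates in which a given point is `[1, 0, 0]`, a given linear form vanishing at
that point is a multiple of `x₂`, and a given vector off that line is the last basis vector. -/
theorem exists_coordinates {v a p : Fin 3 → k} (hv : v ≠ 0) (hav : a ⬝ᵥ v = 0)
    (hap : a ⬝ᵥ p ≠ 0) :
    ∃ B : GL (Fin 3) k, (∀ i, B.val i 0 = v i) ∧ (∀ i, B.val i 2 = p i) ∧
      ∑ i, a i * B.val i 1 = 0 := by
  obtain ⟨j, hj⟩ : ∃ j, v j ≠ 0 := Function.ne_iff.mp hv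
  have hne : v j * a ⬝ᵥ p ≠ 0 := mul_ne_zero hj hap
  -- The cross product of `a` with the `j`-th unit vector serves as the middle column.
  let e : Fin 3 → k := crossProduct a (Pi.single j 1)
  let M : Matrix (Fin 3) (Fin 3) k := Matrix.of fun i => ![v i, e i, p i]
  have hdet : M.det = v j * a ⬝ᵥ p := by
    simp only [dotProduct, Fin.sum_univ_three] at hav ⊢
    fin_cases j
    all_goals
      simp [M, e, Matrix.det_fin_three, cross_apply]
    · linear_combination -p 0 * hav
    · linear_combination -p 1 * hav
    · linear_combination -p 2 * hav
  have hunit : M.det ≠ 0 := hdet ▸ hne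
  refine ⟨Matrix.GeneralLinearGroup.mkOfDetNeZero M hunit, fun i => rfl, fun i => rfl, ?_⟩
  change a ⬝ᵥ crossProduct a (Pi.single j 1) = 0
  exact dot_self_cross a _

/-- The rows of the inverse of a coordinate matrix are the dual coordinates. -/
theorem inv_row_dotProduct_column (B : GL (Fin 3) k) {v : Fin 3 → k} {j : Fin 3}
    (hB : ∀ i, B.val i j = v i) (i : Fin 3) :
    B⁻¹.val i ⬝ᵥ v = (1 : Matrix (Fin 3) (Fin 3) k) i j := by
  have h1 : (B⁻¹ * B).val i j = (1 : Matrix (Fin 3) (Fin 3) k) i j := by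
    rw [inv_mul_cancel]
    rfl
  rw [← h1, Units.val_mul, Matrix.mul_apply']
  congr 1
  ext l
  exact (hB l).symm

theorem exists_linForm_vanishing {v : Fin 3 → k} (hv : v ≠ 0) :
    ∃ a p : Fin 3 → k, a ⬝ᵥ v = 0 ∧ a ⬝ᵥ p ≠ 0 := by
  obtain ⟨j, hj⟩ : ∃ j, v j ≠ 0 := Function.ne_iff.mp hv
  obtain ⟨i, hi⟩ : ∃ i : Fin 3, i ≠ j := exists_ne j
  refine ⟨Pi.single i (v j) - Pi.single j (v i), Pi.single i 1, ?_, ?_⟩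
  · simp [sub_dotProduct, mul_comm]
  · simp [hi, hj]

theorem homogeneousComponent_succ_mul {l : MvPolynomial (Fin 3) k} (hl : l.IsHomogeneous 1)
    (d : ℕ) (f : MvPolynomial (Fin 3) k) :
    MvPolynomial.homogeneousComponent (d + 1) (l * f) =
      l * MvPolynomial.homogeneousComponent d f := by
  conv_lhs => rw [← MvPolynomial.sum_homogeneousComponent f]
  rw [Finset.mul_sum, map_sum]
  have h : ∀ i, MvPolynomial.homogeneousComponent (d + 1)
      (l * MvPolynomial.homogeneousComponent i f) =
      if i = d then l * MvPolynomial.homogeneousComponent i f else 0 := fun i => by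
    rw [MvPolynomial.homogeneousComponent_of_mem
      (hl.mul (MvPolynomial.homogeneousComponent_isHomogeneous i f))]
    congr 1
    rw [add_comm 1 i]
    simp [eq_comm]
  simp only [h]
  rw [Finset.sum_ite_eq']
  split_ifs with hd
  · rfl
  · rw [MvPolynomial.homogeneousComponent_eq_zero _ _ (by simpa using hd), mul_zero]

theorem sum_exponents_eq {A : Type*} [CommRing A] {d : ℕ} {f : MvPolynomial (Fin 3) A}
    (hf : f.IsHomogeneous d) {m : Fin 3 →₀ ℕ} (hm : m ∈ f.support) : m 0 + m 1 + m 2 = d := by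
  have h := hf (MvPolynomial.mem_support_iff.mp hm)
  simpa [Finsupp.weight_apply, Finsupp.sum_fintype, Fin.sum_univ_three] using h

/-- A form vanishing at the first point of a coordinate system is a combination of the other two
coordinates. -/
theorem exists_decomposition_of_vanishing (B : GL (Fin 3) k) {d : ℕ} {f : MvPolynomial (Fin 3) k}
    (hf : f.IsHomogeneous (d + 1)) (h0 : MvPolynomial.eval (fun i => B.val i 0) f = 0) :
    ∃ f₁ f₂ : MvPolynomial (Fin 3) k, f₁.IsHomogeneous d ∧ f₂.IsHomogeneous d ∧
      f = linForm (B⁻¹.val 1) * f₁ + linForm (B⁻¹.val 2) * f₂ := by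
  have hf' := linearSubst_isHomogeneous B hf
  have hmem : linearSubst B f ∈ Ideal.span
      (MvPolynomial.X '' ({1, 2} : Set (Fin 3)) : Set (MvPolynomial (Fin 3) k)) := by
    rw [MvPolynomial.mem_ideal_span_X_image]
    intro m hm
    by_contra hcon
    push Not at hcon
    have hm1 : m 1 = 0 := hcon 1 (by simp)
    have hm2 : m 2 = 0 := hcon 2 (by simp)
    apply MvPolynomial.mem_support_iff.mp hm
    have hev : MvPolynomial.eval (Pi.single 0 1) (linearSubst B f) = 0 := by
      rw [eval_linearSubst, Matrix.mulVec_single_one]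
      exact h0
    rw [MvPolynomial.eval_eq', Finset.sum_eq_single m] at hev
    · simpa [Fin.prod_univ_three, hm1, hm2] using hev
    · intro n hn hnm
      have hne : n 1 ≠ 0 ∨ n 2 ≠ 0 := by
        by_contra hc
        push Not at hc
        apply hnm
        have h1 := sum_exponents_eq hf' hn
        have h2 := sum_exponents_eq hf' hm
        ext i
        fin_cases i
        · simp only [Fin.zero_eta]
          omega
        · simp [hc.1, hm1]
        · simp [hc.2, hm2]
      rcases hne with h | h
      · rw [Finset.prod_eq_zero (Finset.mem_univ (1 : Fin 3)) (by simp [h]), mul_zero]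
      · rw [Finset.prod_eq_zero (Finset.mem_univ (2 : Fin 3)) (by simp [h]), mul_zero]
    · intro h
      exact absurd hm h
  rw [Set.image_pair, Ideal.mem_span_pair] at hmem
  obtain ⟨b, c, hbc⟩ := hmem
  refine ⟨MvPolynomial.homogeneousComponent d (linearSubst B⁻¹ b),
    MvPolynomial.homogeneousComponent d (linearSubst B⁻¹ c),
    MvPolynomial.homogeneousComponent_isHomogeneous _ _,
    MvPolynomial.homogeneousComponent_isHomogeneous _ _, ?_⟩
  rw [← homogeneousComponent_succ_mul (linForm_isHomogeneous _),
    ← homogeneousComponent_succ_mul (linForm_isHomogeneous _), ← map_add]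
  have : linForm (B⁻¹.val 1) * linearSubst B⁻¹ b + linForm (B⁻¹.val 2) * linearSubst B⁻¹ c = f := by
    rw [← linearSubst_X_eq_linForm, ← linearSubst_X_eq_linForm, ← map_mul, ← map_mul, ← map_add]
    have h := linearSubst_inv_apply B⁻¹ f
    rw [inv_inv] at h
    rw [← h, ← hbc]
    ring_nf
  rw [this, MvPolynomial.homogeneousComponent_eq_self hf]

end LinearForms

/-! ### Local ideals of a plane subscheme -/

section Local

variable {k : Type*} [Field k]

theorem eval_eq_zero_of_mem_pointIdeal {x : ℙ k (Fin 3 → k)} {f : MvPolynomial (Fin 3) k}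
    (h : f ∈ pointIdeal x) : MvPolynomial.eval x.rep f = 0 := by
  have h1 := congrArg (Polynomial.eval 1) (RingHom.mem_ker.mp h)
  rw [Polynomial.eval_zero] at h1
  rw [← h1]
  change _ = (Polynomial.aeval (1 : k)) (MvPolynomial.aeval _ f)
  rw [← AlgHom.comp_apply, MvPolynomial.comp_aeval]
  simp only [map_mul, Polynomial.aeval_X, mul_one, Polynomial.aeval_C]
  rfl

theorem mem_pointIdeal_iff {x : ℙ k (Fin 3 → k)} {f : MvPolynomial (Fin 3) k} {d : ℕ}
    (hf : f.IsHomogeneous d) : f ∈ pointIdeal x ↔ MvPolynomial.eval x.rep f = 0 := by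
  refine ⟨eval_eq_zero_of_mem_pointIdeal, fun h => ?_⟩
  rw [pointIdeal, RingHom.mem_ker]
  have h1 := eval₂_scaled_of_isHomogeneous (Polynomial.C) hf (Polynomial.X)
    (fun i => Polynomial.C (x.rep i))
  rw [MvPolynomial.aeval_def]
  simp only [mul_comm (Polynomial.C _)]
  refine h1.trans ?_
  have h2 := MvPolynomial.hom_eval₂ f (RingHom.id k) (Polynomial.C) x.rep
  rw [RingHom.comp_id] at h2
  rw [← h2]
  change _ * Polynomial.C (MvPolynomial.eval x.rep f) = 0
  rw [h, map_zero, mul_zero]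

theorem linForm_mem_pointIdeal_iff {x : ℙ k (Fin 3 → k)} {a : Fin 3 → k} :
    linForm a ∈ pointIdeal x ↔ a ⬝ᵥ x.rep = 0 := by
  rw [mem_pointIdeal_iff (linForm_isHomogeneous a), eval_linForm]

theorem exists_rep_ne_zero (x : ℙ k (Fin 3 → k)) : ∃ i, x.rep i ≠ 0 :=
  Function.ne_iff.mp x.rep_nonzero

theorem exists_X_notMem_pointIdeal (x : ℙ k (Fin 3 → k)) :
    ∃ i, (MvPolynomial.X i : MvPolynomial (Fin 3) k) ∉ pointIdeal x := by
  obtain ⟨i, hi⟩ := exists_rep_ne_zero x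
  exact ⟨i, fun h => hi (by simpa using eval_eq_zero_of_mem_pointIdeal h)⟩

/-- The polynomials which lie in the ideal `I` locally at the point `x`. -/
def locIdeal (I : Ideal (MvPolynomial (Fin 3) k)) (x : ℙ k (Fin 3 → k)) :
    Ideal (MvPolynomial (Fin 3) k) :=
  (I.map (algebraMap _ (Localization.AtPrime (pointIdeal x)))).comap
    (algebraMap _ (Localization.AtPrime (pointIdeal x)))

theorem mem_locIdeal {I : Ideal (MvPolynomial (Fin 3) k)} {x : ℙ k (Fin 3 → k)}
    {f : MvPolynomial (Fin 3) k} : f ∈ locIdeal I x ↔ ∃ s ∉ pointIdeal x, s * f ∈ I := by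
  rw [locIdeal, Ideal.mem_comap,
    IsLocalization.algebraMap_mem_map_algebraMap_iff (pointIdeal x).primeCompl]
  rfl

theorem le_locIdeal (I : Ideal (MvPolynomial (Fin 3) k)) (x : ℙ k (Fin 3 → k)) :
    I ≤ locIdeal I x :=
  Ideal.le_comap_map

theorem mem_locIdeal_of_mul_mem {I : Ideal (MvPolynomial (Fin 3) k)} {x : ℙ k (Fin 3 → k)}
    {s f : MvPolynomial (Fin 3) k} (hs : s ∉ pointIdeal x) (h : s * f ∈ locIdeal I x) :
    f ∈ locIdeal I x := by
  obtain ⟨t, ht, hI⟩ := mem_locIdeal.mp h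
  refine mem_locIdeal.mpr ⟨t * s, fun hts => ?_, by rwa [mul_assoc]⟩
  rcases (pointIdeal_isPrime x).mem_or_mem hts with h | h
  · exact ht h
  · exact hs h

namespace PlaneSubscheme

variable {n : ℕ} (W : PlaneSubscheme k n) (x : ℙ k (Fin 3 → k))

/-- The class of `f / s` in the local ring of the plane at `x`. -/
abbrev localFraction {d : ℕ} (f s : MvPolynomial (Fin 3) k) (hf : f.IsHomogeneous d)
    (hs : s.IsHomogeneous d) (hsx : s ∉ pointIdeal x) :
    HomogeneousLocalization.AtPrime (MvPolynomial.homogeneousSubmodule (Fin 3) k) (pointIdeal x) :=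
  HomogeneousLocalization.mk ⟨d, ⟨f, hf⟩, ⟨s, hs⟩, hsx⟩

variable {x}

theorem val_localFraction {d : ℕ} (f s : MvPolynomial (Fin 3) k) (hf : f.IsHomogeneous d)
    (hs : s.IsHomogeneous d) (hsx : s ∉ pointIdeal x) :
    (localFraction x f s hf hs hsx).val = Localization.mk f ⟨s, hsx⟩ :=
  HomogeneousLocalization.val_mk _

theorem exists_eq_localFraction (y : HomogeneousLocalization.AtPrime
    (MvPolynomial.homogeneousSubmodule (Fin 3) k) (pointIdeal x)) :
    ∃ (d : ℕ) (f s : MvPolynomial (Fin 3) k) (hf : f.IsHomogeneous d) (hs : s.IsHomogeneous d)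
      (hsx : s ∉ pointIdeal x), y = localFraction x f s hf hs hsx := by
  obtain ⟨⟨d, ⟨f, hf⟩, ⟨s, hs⟩, hsx⟩, rfl⟩ := HomogeneousLocalization.mk_surjective y
  exact ⟨d, f, s, hf, hs, hsx, rfl⟩

theorem localFraction_mem_localIdeal_iff {d : ℕ} {f s : MvPolynomial (Fin 3) k}
    {hf : f.IsHomogeneous d} {hs : s.IsHomogeneous d} {hsx : s ∉ pointIdeal x} :
    localFraction x f s hf hs hsx ∈ W.localIdeal x ↔ f ∈ locIdeal W.ideal x := by
  rw [localIdeal, Ideal.mem_comap, HomogeneousLocalization.algebraMap_apply, val_localFraction,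
    Localization.mk_eq_mk', IsLocalization.mk'_mem_map_algebraMap_iff (pointIdeal x).primeCompl,
    mem_locIdeal]
  rfl

theorem localFraction_mem_maximalIdeal_iff {d : ℕ} {f s : MvPolynomial (Fin 3) k}
    {hf : f.IsHomogeneous d} {hs : s.IsHomogeneous d} {hsx : s ∉ pointIdeal x} :
    localFraction x f s hf hs hsx ∈ IsLocalRing.maximalIdeal (HomogeneousLocalization.AtPrime
      (MvPolynomial.homogeneousSubmodule (Fin 3) k) (pointIdeal x)) ↔ f ∈ pointIdeal x := by
  rw [IsLocalRing.mem_maximalIdeal, mem_nonunits_iff,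
    ← HomogeneousLocalization.isUnit_iff_isUnit_val, val_localFraction, Localization.mk_eq_mk',
    IsLocalization.AtPrime.isUnit_mk'_iff _ (pointIdeal x)]
  exact not_not

/-- At a point of multiplicity at most `m`, products of `m` linear forms through the point vanish
on `W`. -/
theorem prod_mem_locIdeal {m : ℕ} (h : W.multiplicity x ≤ m) (l : ℕ → MvPolynomial (Fin 3) k)
    (hl : ∀ i, (l i).IsHomogeneous 1) (hlx : ∀ i, l i ∈ pointIdeal x) :
    ∏ i ∈ Finset.range m, l i ∈ locIdeal W.ideal x := by
  obtain ⟨e, he⟩ := exists_X_notMem_pointIdeal x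
  have hX := MvPolynomial.isHomogeneous_X k e
  have key := prod_mem_of_length_le h (fun i => localFraction x (l i) _ (hl i) hX he)
    fun (i : ℕ) => localFraction_mem_maximalIdeal_iff.mpr (hlx i)
  rw [localIdeal, Ideal.mem_comap, map_prod] at key
  rw [locIdeal, Ideal.mem_comap, map_prod]
  have hstep : ∀ i, algebraMap (MvPolynomial (Fin 3) k)
      (Localization.AtPrime (pointIdeal x)) (l i) =
      algebraMap _ (Localization.AtPrime (pointIdeal x)) (localFraction x (l i) _ (hl i) hX he) *
        algebraMap (MvPolynomial (Fin 3) k) (Localization.AtPrime (pointIdeal x))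
          (MvPolynomial.X e) := by
    intro i
    rw [HomogeneousLocalization.algebraMap_apply, val_localFraction, Localization.mk_eq_mk']
    exact (IsLocalization.mk'_spec _ (l i)
      (⟨MvPolynomial.X e, he⟩ : (pointIdeal x).primeCompl)).symm
  simp only [hstep, Finset.prod_mul_distrib]
  exact Ideal.mul_mem_right _ _ key

/-- If locally at `x` the ideal of `W` contains a form `F` which is smooth at `x` and transversal
to a linear form `l`, and it contains `l ^ c`, then the multiplicity of `W` at `x` is at
most `c`. -/
theorem multiplicity_le (B : GL (Fin 3) k) (hB : ∀ i, B.val i 0 = x.rep i) {c d : ℕ}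
    {F F₁ F₂ : MvPolynomial (Fin 3) k} (hF : F ∈ locIdeal W.ideal x)
    (hF₁ : F₁.IsHomogeneous d) (hF₂ : F₂.IsHomogeneous d)
    (hFF : F = linForm (B⁻¹.val 1) * F₁ + linForm (B⁻¹.val 2) * F₂)
    (hF₂x : F₂ ∉ pointIdeal x) (hc : linForm (B⁻¹.val 1) ^ c ∈ locIdeal W.ideal x) :
    W.multiplicity x ≤ c := by
  obtain ⟨e, he⟩ := exists_X_notMem_pointIdeal x
  have hX := MvPolynomial.isHomogeneous_X k e
  have hl₁ := linForm_isHomogeneous (B⁻¹.val 1)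
  have hl₂ := linForm_isHomogeneous (B⁻¹.val 2)
  set l₁ := linForm (B⁻¹.val 1)
  set l₂ := linForm (B⁻¹.val 2)
  refine length_le_of_pow_mem (u := localFraction x l₁ _ hl₁ hX he) c ?_ ?_
  · intro y hy
    obtain ⟨m, f, s, hf, hs, hsx, rfl⟩ := exists_eq_localFraction y
    rw [localFraction_mem_maximalIdeal_iff] at hy
    have hfX : (f * MvPolynomial.X e).IsHomogeneous (m + 1) := hf.mul hX
    obtain ⟨f₁, f₂, hf₁, hf₂, hff⟩ := exists_decomposition_of_vanishing B hfX (by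
      rw [funext hB]
      exact eval_eq_zero_of_mem_pointIdeal (Ideal.mul_mem_right _ _ hy))
    change _ = l₁ * f₁ + l₂ * f₂ at hff
    have hP := pointIdeal_isPrime x
    have hden : s * MvPolynomial.X e * F₂ ∉ pointIdeal x := fun h =>
      (hP.mem_or_mem h).elim (fun h => (hP.mem_or_mem h).elim hsx he) hF₂x
    have hdenh : (s * MvPolynomial.X e * F₂).IsHomogeneous (m + 1 + d) := (hs.mul hX).mul hF₂
    have hw : ((f₁ * F₂ - F₁ * f₂) * MvPolynomial.X e).IsHomogeneous (m + 1 + d) := by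
      have h1 : (F₁ * f₂).IsHomogeneous (m + d) := add_comm d m ▸ hF₁.mul hf₂
      have h2 := ((hf₁.mul hF₂).sub h1).mul hX
      rwa [show m + 1 + d = m + d + 1 by omega]
    have hi : (f₂ * F).IsHomogeneous (m + 1 + d) := by
      have h1 : F.IsHomogeneous (1 + d) := hFF ▸ (hl₁.mul hF₁).add (hl₂.mul hF₂)
      have h2 := hf₂.mul h1
      rwa [show m + 1 + d = m + (1 + d) by omega]
    have heq : localFraction x f s hf hs hsx = localFraction x _ _ hi hdenh hden +
        localFraction x _ _ hw hdenh hden * localFraction x l₁ _ hl₁ hX he := by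
      apply HomogeneousLocalization.val_injective
      rw [HomogeneousLocalization.val_add, HomogeneousLocalization.val_mul]
      simp only [val_localFraction, Localization.mk_mul, Localization.add_mk]
      rw [Localization.mk_eq_mk_iff, Localization.r_iff_exists]
      refine ⟨1, ?_⟩
      simp only [Submonoid.coe_mul, OneMemClass.coe_one, one_mul]
      rw [hFF]
      linear_combination (s * MvPolynomial.X e * F₂ * F₂ * s * MvPolynomial.X e) * hff
    rw [heq]
    refine Ideal.add_mem _ (Ideal.mem_sup_left ?_) (Ideal.mem_sup_right ?_)
    · rw [localFraction_mem_localIdeal_iff]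
      exact Ideal.mul_mem_left _ _ hF
    · exact Ideal.mul_mem_left _ _ (Ideal.mem_span_singleton_self _)
  · rw [localFraction, ← HomogeneousLocalization.mk_pow]
    exact (W.localFraction_mem_localIdeal_iff (f := l₁ ^ c) (s := MvPolynomial.X e ^ c)
      (hf := by simpa using hl₁.pow c) (hs := by simpa using hX.pow c)
      (hsx := fun h => he ((pointIdeal_isPrime x).mem_of_pow_mem c h))).mpr hc

theorem ideal_le_pointIdeal (h : W.multiplicity x ≠ 0) : W.ideal ≤ pointIdeal x := by
  intro f hf
  by_contra hfx
  apply h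
  have h1 : (1 : MvPolynomial (Fin 3) k) ∈ locIdeal W.ideal x :=
    mem_locIdeal.mpr ⟨f, hfx, by simpa using hf⟩
  have h2 := (W.localFraction_mem_localIdeal_iff (f := 1) (s := 1)
    (hf := MvPolynomial.isHomogeneous_one _ _) (hs := MvPolynomial.isHomogeneous_one _ _)
    (hsx := (Ideal.ne_top_iff_one _).mp (pointIdeal_isPrime x).ne_top)).mpr h1
  have h3 : localFraction x 1 1 (MvPolynomial.isHomogeneous_one _ _)
      (MvPolynomial.isHomogeneous_one _ _)
      ((Ideal.ne_top_iff_one _).mp (pointIdeal_isPrime x).ne_top) = 1 := by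
    apply HomogeneousLocalization.val_injective
    rw [val_localFraction, HomogeneousLocalization.val_one]
    exact Localization.mk_one
  rw [h3] at h2
  rw [multiplicity, Module.length_eq_zero_iff]
  exact Ideal.Quotient.subsingleton_iff.mpr ((Ideal.eq_top_iff_one _).mpr h2)

theorem homogeneousComponent_mem {f : MvPolynomial (Fin 3) k} (hf : f ∈ W.ideal) (d : ℕ) :
    MvPolynomial.homogeneousComponent d f ∈ W.ideal :=
  MvPolynomial.homogeneousComponent_mem_of_mem W.homogeneous hf d

theorem mem_of_pow_irrelevant_mul_le {f : MvPolynomial (Fin 3) k} (m : ℕ)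
    (h : ∀ g ∈ Ideal.span (Set.range (MvPolynomial.X (R := k) (σ := Fin 3))) ^ m,
      g * f ∈ W.ideal) : f ∈ W.ideal := by
  induction m with
  | zero => simpa using h 1 (by simp)
  | succ m ih =>
    refine ih fun g hg => W.saturated _ fun i => ?_
    rw [← mul_assoc]
    refine h _ ?_
    rw [pow_succ']
    exact Ideal.mul_mem_mul (Ideal.subset_span ⟨i, rfl⟩) hg

/-- A form lies in a saturated ideal if it does so locally at every point: the colon ideal has no
zero in the plane, hence contains a power of the irrelevant ideal. -/
theorem mem_of_forall_mem_locIdeal [IsAlgClosed k] {f : MvPolynomial (Fin 3) k} {d : ℕ}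
    (hf : f.IsHomogeneous d) (h : ∀ y, f ∈ locIdeal W.ideal y) : f ∈ W.ideal := by
  let J : Ideal (MvPolynomial (Fin 3) k) :=
    Submodule.comap (LinearMap.mulRight (MvPolynomial (Fin 3) k) f) W.ideal
  have hJ : ∀ g, g ∈ J ↔ g * f ∈ W.ideal := fun g => Iff.rfl
  have hJhom : ∀ g ∈ J, ∀ e, MvPolynomial.homogeneousComponent e g ∈ J := by
    intro g hg e
    have h1 := W.homogeneousComponent_mem ((hJ g).mp hg) (e + d)
    rw [hJ]
    convert h1 using 1
    conv_rhs => rw [← MvPolynomial.sum_homogeneousComponent g]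
    rw [Finset.sum_mul, map_sum]
    have h2 : ∀ i, MvPolynomial.homogeneousComponent (e + d)
        (MvPolynomial.homogeneousComponent i g * f) =
        if i = e then MvPolynomial.homogeneousComponent i g * f else 0 := fun i => by
      rw [MvPolynomial.homogeneousComponent_of_mem
        ((MvPolynomial.homogeneousComponent_isHomogeneous i g).mul hf)]
      simp [eq_comm]
    simp only [h2]
    rw [Finset.sum_ite_eq']
    split_ifs with hd
    · rfl
    · rw [MvPolynomial.homogeneousComponent_eq_zero _ _ (by simpa using hd), zero_mul]
  have hzero : ∀ v ∈ MvPolynomial.zeroLocus k J, v = 0 := by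
    intro v hv
    by_contra hv0
    let y : ℙ k (Fin 3 → k) := Projectivization.mk k v hv0
    obtain ⟨a, ha⟩ := Projectivization.exists_smul_eq_mk_rep k v hv0
    have hJy : J ≤ pointIdeal y := by
      intro g hg
      rw [← MvPolynomial.sum_homogeneousComponent g]
      refine Ideal.sum_mem _ fun e _ => ?_
      have hge := MvPolynomial.homogeneousComponent_isHomogeneous e g
      rw [mem_pointIdeal_iff hge, ← ha]
      have h1 := eval₂_scaled_of_isHomogeneous (RingHom.id k) hge (a : k) v
      have h2 : MvPolynomial.eval₂ (RingHom.id k) v (MvPolynomial.homogeneousComponent e g) = 0 :=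
        hv _ (hJhom g hg e)
      rw [h2, mul_zero] at h1
      exact h1
    obtain ⟨s, hs, hsf⟩ := mem_locIdeal.mp (h y)
    exact hs (hJy hsf)
  have hrad : Ideal.span (Set.range (MvPolynomial.X (R := k) (σ := Fin 3))) ≤ J.radical := by
    rw [← MvPolynomial.vanishingIdeal_zeroLocus_eq_radical (K := k), Ideal.span_le]
    rintro _ ⟨i, rfl⟩
    intro v hv
    simp [hzero v hv]
  obtain ⟨m, hm⟩ := Ideal.exists_pow_le_of_le_radical_of_fg hrad
    (Submodule.fg_span (Set.finite_range _))
  exact W.mem_of_pow_irrelevant_mul_le m fun g hg => hm hg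

end PlaneSubscheme

end Local

/-! ### Frames of six points and the closure of their orbit -/

section Frames

variable {k : Type*} [Field k]

/-- If every linear form over `k` which vanishes at `x` vanishes at a vector `v` over a larger
field, then `v` is proportional to `x`. -/
theorem eq_smul_of_forall_linForm {L : Type*} [Field L] (τ : k →+* L) {x : Fin 3 → k}
    {v : Fin 3 → L} {j : Fin 3} (hj : x j ≠ 0)
    (h : ∀ a : Fin 3 → k, a ⬝ᵥ x = 0 → (fun i => τ (a i)) ⬝ᵥ v = 0) (i : Fin 3) :
    v i = v j / τ (x j) * τ (x i) := by
  have hj' : τ (x j) ≠ 0 := (map_ne_zero _).mpr hj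
  have h1 := h (Pi.single i (x j) - Pi.single j (x i)) (by simp [sub_dotProduct, mul_comm])
  have h2 : (fun l => τ ((Pi.single i (x j) - Pi.single j (x i) : Fin 3 → k) l)) =
      Pi.single i (τ (x j)) - Pi.single j (τ (x i)) := by
    ext l
    simp [Pi.single_apply, apply_ite (τ)]
  rw [h2, sub_dotProduct, single_dotProduct, single_dotProduct] at h1
  field_simp
  linear_combination h1

theorem exists_linForm_separating {x y : ℙ k (Fin 3 → k)} (hxy : x ≠ y) :
    ∃ a : Fin 3 → k, a ⬝ᵥ x.rep = 0 ∧ a ⬝ᵥ y.rep ≠ 0 := by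
  by_contra hcon
  push Not at hcon
  obtain ⟨j, hj⟩ := exists_rep_ne_zero x
  have h := eq_smul_of_forall_linForm (RingHom.id k) hj hcon
  apply hxy
  rw [← x.mk_rep, ← y.mk_rep]
  symm
  rw [Projectivization.mk_eq_mk_iff']
  exact ⟨y.rep j / x.rep j, (funext h).symm⟩

theorem exists_comp_eq_of_ker_le {E F G : Type*} [AddCommGroup E] [Module k E] [AddCommGroup F]
    [Module k F] [AddCommGroup G] [Module k G] (f : E →ₗ[k] F) (g : E →ₗ[k] G)
    (h : LinearMap.ker g ≤ LinearMap.ker f) : ∃ φ : G →ₗ[k] F, f = φ ∘ₗ g := by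
  obtain ⟨φ, hφ⟩ := LinearMap.exists_extend
    ((LinearMap.ker g).liftQ f h ∘ₗ g.quotKerEquivRange.symm.toLinearMap)
  refine ⟨φ, LinearMap.ext fun x => ?_⟩
  have h1 := LinearMap.congr_fun hφ ⟨g x, x, rfl⟩
  have h2 : g.quotKerEquivRange.symm ⟨g x, x, rfl⟩ = Submodule.Quotient.mk x := by
    rw [LinearEquiv.symm_apply_eq]
    rfl
  simp only [LinearMap.comp_apply, LinearEquiv.coe_coe, h2, Submodule.subtype_apply,
    Submodule.liftQ_apply] at h1
  exact h1.symm

/-- The index set for the coordinates of a frame in degree six. -/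
abbrev FrameIndex : Type := Fin 6 × {m : Fin 3 →₀ ℕ // m.degree = 6}

/-- The coordinates of the map `h ∘ (f ↦ (f (g z₀), …, f (g z₅)))` on forms of degree six. -/
def pointFrame {B : Type*} [CommRing B] [Algebra k B] (z : Fin 6 → Fin 3 → k)
    (g : Matrix (Fin 3) (Fin 3) B) (h : Matrix (Fin 6) (Fin 6) B) : FrameIndex → B :=
  fun im => ∑ j, h im.1 j * MvPolynomial.aeval (g.mulVec fun l => algebraMap k B (z j l))
    (MvPolynomial.monomial im.2.1 (1 : k))

theorem map_pointFrame {B B' : Type*} [CommRing B] [Algebra k B] [CommRing B'] [Algebra k B']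
    (φ : B →ₐ[k] B') (z : Fin 6 → Fin 3 → k) (g : Matrix (Fin 3) (Fin 3) B)
    (h : Matrix (Fin 6) (Fin 6) B) (im : FrameIndex) :
    φ (pointFrame z g h im) = pointFrame z (g.map φ) (h.map φ) im := by
  simp only [pointFrame, map_sum, map_mul, Matrix.map_apply]
  refine Finset.sum_congr rfl fun j _ => ?_
  rw [← AlgHom.comp_apply, MvPolynomial.comp_aeval]
  congr 3
  ext i
  simp [Matrix.mulVec, dotProduct]

/-- The polynomials in the coordinates of a frame which vanish on all frames of the images of the
points `z` under linear maps. -/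
def orbitEquations (z : Fin 6 → Fin 3 → k) : Set (MvPolynomial FrameIndex k) :=
  {P | ∀ g h, MvPolynomial.eval (pointFrame z g h) P = 0}

variable {Z : PlaneSubscheme k 6} {z : Fin 6 → ℙ k (Fin 3 → k)}

theorem mem_smul_ideal_iff_eval (hZ : Z.ideal = ⨅ i, pointIdeal (z i)) (g : GL (Fin 3) k) {d : ℕ}
    {f : MvPolynomial (Fin 3) k} (hf : f.IsHomogeneous d) :
    f ∈ (g • Z).ideal ↔ ∀ j, MvPolynomial.eval (g.val.mulVec (z j).rep) f = 0 := by
  rw [mem_smul_ideal, hZ, Ideal.mem_iInf]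
  refine forall_congr' fun j => ?_
  rw [mem_pointIdeal_iff (linearSubst_isHomogeneous g hf), eval_linearSubst]

/-- Evaluation of the forms of degree `d` at finitely many vectors. -/
def evalForms (d : ℕ) (u : Fin 6 → Fin 3 → k) :
    MvPolynomial.homogeneousSubmodule (Fin 3) k d →ₗ[k] (Fin 6 → k) :=
  LinearMap.pi fun j => (MvPolynomial.aeval (u j)).toLinearMap ∘ₗ
    (MvPolynomial.homogeneousSubmodule (Fin 3) k d).subtype

theorem evalForms_apply (d : ℕ) (u : Fin 6 → Fin 3 → k)
    (f : MvPolynomial.homogeneousSubmodule (Fin 3) k d) (j : Fin 6) :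
    evalForms d u f j = MvPolynomial.eval (u j) f.1 := rfl

theorem ker_evalForms (hZ : Z.ideal = ⨅ i, pointIdeal (z i)) (g : GL (Fin 3) k) (d : ℕ) :
    LinearMap.ker (evalForms d fun j => g.val.mulVec (z j).rep) =
      degreePart (g • Z).ideal d := by
  ext f
  rw [LinearMap.mem_ker]
  change _ ↔ f.1 ∈ (g • Z).ideal
  rw [mem_smul_ideal_iff_eval hZ g f.2]
  exact ⟨fun h j => congrFun h j, fun h => funext h⟩

theorem evalForms_surjective (hz : Function.Injective z) (g : GL (Fin 3) k) :
    Function.Surjective (evalForms 6 fun j => g.val.mulVec (z j).rep) := by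
  have hex : ∀ j, ∃ f : MvPolynomial.homogeneousSubmodule (Fin 3) k 6,
      evalForms 6 (fun j => g.val.mulVec (z j).rep) f = Pi.single j 1 := by
    intro j
    have hl : ∀ l, ∃ a : Fin 3 → k, (l ≠ j → a ⬝ᵥ (z l).rep = 0) ∧ a ⬝ᵥ (z j).rep ≠ 0 := by
      intro l
      by_cases hlj : l = j
      · obtain ⟨i, hi⟩ := exists_rep_ne_zero (z j)
        exact ⟨Pi.single i 1, fun h => absurd hlj h, by simpa using hi⟩
      · obtain ⟨a, ha, ha'⟩ := exists_linForm_separating (fun h => hlj (hz h))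
        exact ⟨a, fun _ => ha, ha'⟩
    choose a ha ha' using hl
    let f₀ : MvPolynomial (Fin 3) k := ∏ l, linForm (a l)
    have hf₀ : f₀.IsHomogeneous 6 := by
      have := MvPolynomial.IsHomogeneous.prod Finset.univ (fun l => linForm (a l)) (fun _ => 1)
        fun l _ => linForm_isHomogeneous (a l)
      simpa using this
    have hev : ∀ l, MvPolynomial.eval (z l).rep f₀ = ∏ i, a i ⬝ᵥ (z l).rep := by
      intro l
      simp [f₀, map_prod, eval_linForm]
    have hev0 : ∀ l, MvPolynomial.eval (g.val.mulVec (z l).rep) (linearSubst g⁻¹ f₀) =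
        ∏ i, a i ⬝ᵥ (z l).rep := by
      intro l
      rw [← eval_linearSubst, linearSubst_inv_apply, hev]
    have hne : ∏ i, a i ⬝ᵥ (z j).rep ≠ 0 := Finset.prod_ne_zero_iff.mpr fun i _ => ha' i
    refine ⟨(∏ i, a i ⬝ᵥ (z j).rep)⁻¹ •
      ⟨linearSubst g⁻¹ f₀, linearSubst_isHomogeneous g⁻¹ hf₀⟩, ?_⟩
    ext l
    rw [map_smul, Pi.smul_apply, evalForms_apply, hev0, smul_eq_mul]
    by_cases hlj : l = j
    · subst hlj
      simp [hne]
    · have h0 : ∏ i, a i ⬝ᵥ (z l).rep = 0 := Finset.prod_eq_zero (Finset.mem_univ l) (ha l hlj)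
      rw [Pi.single_eq_of_ne hlj, h0, mul_zero]
  choose f hf using hex
  intro w
  refine ⟨∑ j, w j • f j, ?_⟩
  rw [map_sum]
  ext l
  simp [hf, Pi.single_apply]

namespace PlaneSubscheme.HilbertFrame

theorem coords_comp (M : HilbertFrame k 6)
    (e : MvPolynomial.homogeneousSubmodule (Fin 3) k 6 →ₗ[k] (Fin 6 → k))
    (φ : (Fin 6 → k) →ₗ[k] (Fin 6 → k)) (h : M.map = φ ∘ₗ e) (im : FrameIndex) :
    M.coords im = ∑ l, LinearMap.toMatrix' φ im.1 l *
      e ⟨MvPolynomial.monomial im.2.1 1, MvPolynomial.isHomogeneous_monomial 1 im.2.2⟩ l := by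
  rw [coords, h, LinearMap.comp_apply, ← LinearMap.toMatrix'_mulVec φ]
  rfl

/-- The equations of the orbit hold for all frames of a subscheme if they hold for one. -/
theorem eval_coords_eq_zero_of_scheme_eq {z : Fin 6 → Fin 3 → k} {M M' : HilbertFrame k 6}
    (h : M'.scheme = M.scheme)
    (hM : ∀ P ∈ orbitEquations z, MvPolynomial.eval M'.coords P = 0) :
    ∀ P ∈ orbitEquations z, MvPolynomial.eval M.coords P = 0 := by
  intro P hP
  obtain ⟨φ, hφ⟩ := exists_comp_eq_of_ker_le M.map M'.map (by rw [M.ker_eq, M'.ker_eq, h])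
  let A := LinearMap.toMatrix' φ
  let s : MvPolynomial FrameIndex k →ₐ[k] MvPolynomial FrameIndex k :=
    MvPolynomial.aeval fun im => ∑ l, MvPolynomial.C (A im.1 l) * MvPolynomial.X (l, im.2)
  have hs : ∀ c : FrameIndex → k, MvPolynomial.eval c (s P) =
      MvPolynomial.eval (fun im => ∑ l, A im.1 l * c (l, im.2)) P := by
    intro c
    change MvPolynomial.aeval c (MvPolynomial.aeval _ P) = MvPolynomial.aeval _ P
    rw [← AlgHom.comp_apply, MvPolynomial.comp_aeval]
    simp
  have hsP : s P ∈ orbitEquations z := by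
    intro g h
    rw [hs]
    have := hP g (A * h)
    convert this using 3
    ext im
    simp only [pointFrame, Matrix.mul_apply, Finset.mul_sum, Finset.sum_mul]
    rw [Finset.sum_comm]
    simp only [mul_assoc]
  have h1 := hM _ hsP
  rw [hs] at h1
  convert h1 using 3
  ext im
  exact coords_comp M M'.map φ hφ im

end PlaneSubscheme.HilbertFrame

open PlaneSubscheme in
/-- A subscheme in the orbit closure of six distinct points has a frame, which satisfies the
equations of the orbit. -/
theorem exists_frame_of_mem_closure (hz : Function.Injective z)
    (hZ : Z.ideal = ⨅ i, pointIdeal (z i)) {W : PlaneSubscheme k 6}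
    (hW : W ∈ closure (MulAction.orbit PGL(3, k) Z)) :
    ∃ M : HilbertFrame k 6, M.scheme = W ∧
      ∀ P ∈ orbitEquations (fun j => (z j).rep), MvPolynomial.eval M.coords P = 0 := by
  let C : Set (PlaneSubscheme k 6) := {V | ∃ M : HilbertFrame k 6, M.scheme = V ∧
    ∀ P ∈ orbitEquations (fun j => (z j).rep), MvPolynomial.eval M.coords P = 0}
  suffices hC : closure (MulAction.orbit PGL(3, k) Z) ⊆ C from hC hW
  refine closure_minimal ?_ ?_
  · rintro _ ⟨γ, rfl⟩
    induction γ using Matrix.ProjGenLinGroup.induction_on with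
    | mk g =>
    have hg : Matrix.ProjGenLinGroup.mk g • Z = g • Z := rfl
    change Matrix.ProjGenLinGroup.mk g • Z ∈ C
    rw [hg]
    let M : HilbertFrame k 6 := ⟨g • Z, evalForms 6 fun j => g.val.mulVec (z j).rep,
      evalForms_surjective hz g, ker_evalForms hZ g 6⟩
    refine ⟨M, rfl, fun P hP => ?_⟩
    have := hP g.val 1
    convert this using 3
    ext im
    simp only [pointFrame, Matrix.one_apply, ite_mul, one_mul, zero_mul]
    rw [Finset.sum_ite_eq, if_pos (Finset.mem_univ _)]
    rfl
  · rw [isClosed_coinduced, isClosed_induced_iff]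
    refine ⟨PrimeSpectrum.zeroLocus (orbitEquations fun j => (z j).rep),
      PrimeSpectrum.isClosed_zeroLocus _, ?_⟩
    ext M
    constructor
    · exact fun h => ⟨M, rfl, fun P hP => h hP M.coords rfl⟩
    · rintro ⟨M', hM', h⟩ P hP x hx
      rw [Set.mem_singleton_iff.mp hx]
      exact HilbertFrame.eval_coords_eq_zero_of_scheme_eq hM' h P hP

end Frames

/-! ### A one-parameter family over a valuation ring -/

section Family

theorem isUnit_det_of_map {n : Type*} [Fintype n] [DecidableEq n] {B L : Type*} [CommRing B]
    [IsDomain B] [Field L] [Algebra B L] [IsFractionRing B L] {B' : Type*} [CommRing B']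
    [Nontrivial B'] (φ : B →+* B') (A : Matrix n n B) (h : A.map φ = 1) :
    IsUnit (A.map (algebraMap B L)).det := by
  rw [isUnit_iff_ne_zero, ← RingHom.mapMatrix_apply, ← RingHom.map_det]
  intro h0
  have h1 : A.det = 0 := IsFractionRing.injective B L (by rw [h0, map_zero])
  have h2 := congrArg φ h1
  rw [RingHom.map_det, RingHom.mapMatrix_apply, h, Matrix.det_one, map_zero] at h2
  exact one_ne_zero h2

/-- A family of images of the six points `z` under a linear map, over a valuation ring `V` with
fraction field `K`, whose sixth Hilbert point specializes to the one with frame coordinates `c`. -/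
structure LimitFamily {k : Type*} [Field k] (z : Fin 6 → Fin 3 → k) (c : FrameIndex → k)
    (K : Type*) [Field K] [Algebra k K] where
  /-- the valuation ring -/
  V : ValuationSubring K
  /-- the inclusion of the constants -/
  ι : k →+* V
  /-- the linear map that moves the points -/
  G : Matrix (Fin 3) (Fin 3) K
  /-- the change of basis that makes the limit of the Hilbert point visible -/
  H : Matrix (Fin 6) (Fin 6) K
  /-- the integral coordinates of the moving frame -/
  N : FrameIndex → V
  ι_eq : ∀ a, (ι a : K) = algebraMap k K a
  isUnit_det_G : IsUnit G.det
  isUnit_det_H : IsUnit H.det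
  N_eq : ∀ im, (N im : K) = pointFrame z G H im
  residue_N : ∀ im, IsLocalRing.residue V (N im) = IsLocalRing.residue V (ι (c im))

/-- A frame satisfying the equations of the orbit of six points is the reduction of a frame of six
moved points over a valuation ring: the generic frame specializes to the given one, and a
valuation ring dominates this specialization. -/
theorem exists_valuation_family.{u} {k : Type u} [Field k] {z : Fin 6 → Fin 3 → k}
    {c : FrameIndex → k} (hc : ∀ P ∈ orbitEquations z, MvPolynomial.eval c P = 0) :
    ∃ (K : Type u) (_ : Field K) (_ : Algebra k K), Nonempty (LimitFamily z c K) := by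
  let B := MvPolynomial ((Fin 3 × Fin 3) ⊕ (Fin 6 × Fin 6)) k
  let K := FractionRing B
  let g : Matrix (Fin 3) (Fin 3) B := Matrix.of fun i j => MvPolynomial.X (Sum.inl (i, j))
  let h : Matrix (Fin 6) (Fin 6) B := Matrix.of fun i j => MvPolynomial.X (Sum.inr (i, j))
  let β : B →ₐ[k] K := IsScalarTower.toAlgHom k B K
  have hβ : Function.Injective β := IsFractionRing.injective B K
  let R := MvPolynomial FrameIndex k
  let ψ : R →ₐ[k] K := MvPolynomial.aeval (pointFrame z (g.map β) (h.map β))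
  have hψ : ∀ P, ψ P = 0 → MvPolynomial.eval c P = 0 := by
    intro P hP
    apply hc
    intro g' h'
    have h1 : β (MvPolynomial.aeval (pointFrame z g h) P) = 0 := by
      rw [← AlgHom.comp_apply, MvPolynomial.comp_aeval, ← hP]
      simp only [map_pointFrame, ψ]
    have h2 : MvPolynomial.aeval (pointFrame z g h) P = 0 := hβ (by rw [h1, map_zero])
    let ε : B →ₐ[k] k := MvPolynomial.aeval
      (Sum.elim (fun ij => g' ij.1 ij.2) (fun ij => h' ij.1 ij.2))
    have h3 := congrArg ε h2
    rw [← AlgHom.comp_apply, MvPolynomial.comp_aeval, map_zero] at h3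
    simp only [map_pointFrame] at h3
    have hg : g.map ε = g' := by
      ext i j
      exact MvPolynomial.aeval_X _ _
    have hh : h.map ε = h' := by
      ext i j
      exact MvPolynomial.aeval_X _ _
    rw [hg, hh] at h3
    exact h3
  let m : Ideal R := RingHom.ker (MvPolynomial.eval c)
  have hm : m.IsPrime := RingHom.ker_isPrime _
  have hunit : ∀ y : m.primeCompl, IsUnit (ψ.toRingHom y) := by
    intro y
    rw [isUnit_iff_ne_zero]
    exact fun h0 => y.2 (hψ _ h0)
  let f : Localization.AtPrime m →+* K := IsLocalization.lift hunit
  have hf : ∀ P, f (algebraMap R _ P) = ψ P := fun P => IsLocalization.lift_eq hunit P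
  obtain ⟨V, hV, hloc⟩ := IsLocalRing.exists_factor_valuationRing f
  let θ : Localization.AtPrime m →+* V := f.codRestrict V.toSubring hV
  have hθ : ∀ P, (θ (algebraMap R _ P) : K) = ψ P := fun P => hf P
  refine ⟨K, inferInstance, inferInstance, ⟨V, θ.comp ((algebraMap R _).comp MvPolynomial.C),
    g.map β, h.map β, fun im => θ (algebraMap R _ (MvPolynomial.X im)), ?_, ?_, ?_, ?_, ?_⟩⟩
  · intro a
    exact (hθ (MvPolynomial.C a)).trans (MvPolynomial.aeval_C _ a)
  · exact isUnit_det_of_map (L := K)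
      (MvPolynomial.eval (Sum.elim (fun ij => (1 : Matrix (Fin 3) (Fin 3) k) ij.1 ij.2)
        (fun ij => (1 : Matrix (Fin 6) (Fin 6) k) ij.1 ij.2))) g (by ext i j; simp [g])
  · exact isUnit_det_of_map (L := K)
      (MvPolynomial.eval (Sum.elim (fun ij => (1 : Matrix (Fin 3) (Fin 3) k) ij.1 ij.2)
        (fun ij => (1 : Matrix (Fin 6) (Fin 6) k) ij.1 ij.2))) h (by ext i j; simp [h])
  · intro im
    exact (hθ (MvPolynomial.X im)).trans (MvPolynomial.aeval_X _ im)
  · intro im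
    rw [← sub_eq_zero, ← map_sub, RingHom.comp_apply, RingHom.comp_apply, ← map_sub, ← map_sub,
      IsLocalRing.residue_eq_zero_iff, IsLocalRing.mem_maximalIdeal, mem_nonunits_iff]
    intro hu
    have h1 := hloc.map_nonunit _ hu
    rw [IsLocalization.AtPrime.isUnit_to_map_iff _ m] at h1
    refine h1 (RingHom.mem_ker.mpr ((map_sub _ _ _).trans ?_))
    exact sub_eq_zero.mpr ((MvPolynomial.eval_X im).trans (MvPolynomial.eval_C (c im)).symm)

end Family

/-! ### Lifting and specializing forms of degree six -/

section Specialization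

instance : Finite {m : Fin 3 →₀ ℕ // m.degree = 6} := by
  refine Finite.of_injective (β := Fin 3 → Fin 7)
    (fun m i => ⟨m.1 i, Nat.lt_succ_of_le ((Finsupp.le_degree i m.1).trans_eq m.2)⟩) ?_
  intro m m' h
  ext i
  exact congrArg Fin.val (congrFun h i)

instance : Fintype {m : Fin 3 →₀ ℕ // m.degree = 6} := Fintype.ofFinite _

theorem eq_sum_monomial_of_isHomogeneous {A : Type*} [CommRing A] {F : MvPolynomial (Fin 3) A}
    (hF : F.IsHomogeneous 6) :
    F = ∑ m : {m : Fin 3 →₀ ℕ // m.degree = 6}, MvPolynomial.coeff m.1 F •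
      MvPolynomial.monomial m.1 1 := by
  ext n
  rw [MvPolynomial.coeff_sum]
  simp only [MvPolynomial.coeff_smul, MvPolynomial.coeff_monomial, smul_eq_mul, mul_ite, mul_one,
    mul_zero]
  by_cases hn : n.degree = 6
  · rw [Finset.sum_eq_single ⟨n, hn⟩]
    · simp
    · intro m _ hm
      exact if_neg fun h => hm (Subtype.ext h)
    · simp
  · rw [hF.coeff_eq_zero hn, Finset.sum_eq_zero]
    intro m _
    exact if_neg fun h => hn ((congrArg _ h.symm).trans m.2)

/-- The linear map on forms of degree six with the given matrix of coordinates. -/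
def frameMap {A : Type*} [CommRing A] (N : FrameIndex → A) :
    MvPolynomial (Fin 3) A →ₗ[A] (Fin 6 → A) :=
  LinearMap.pi fun i => ∑ m : {m : Fin 3 →₀ ℕ // m.degree = 6},
    N (i, m) • MvPolynomial.lcoeff A m.1

theorem frameMap_apply {A : Type*} [CommRing A] (N : FrameIndex → A) (F : MvPolynomial (Fin 3) A)
    (i : Fin 6) : frameMap N F i = ∑ m : {m : Fin 3 →₀ ℕ // m.degree = 6},
      N (i, m) * MvPolynomial.coeff m.1 F := by
  simp [frameMap, LinearMap.sum_apply]

theorem map_frameMap {A B : Type*} [CommRing A] [CommRing B] (φ : A →+* B) (N : FrameIndex → A)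
    (F : MvPolynomial (Fin 3) A) (i : Fin 6) :
    φ (frameMap N F i) = frameMap (fun im => φ (N im)) (MvPolynomial.map φ F) i := by
  simp [frameMap_apply, MvPolynomial.coeff_map]

theorem PlaneSubscheme.HilbertFrame.map_apply_eq_frameMap {k : Type*} [Field k]
    (M : HilbertFrame k 6) (f : MvPolynomial.homogeneousSubmodule (Fin 3) k 6) (i : Fin 6) :
    M.map f i = frameMap M.coords f.1 i := by
  have h : f = ∑ m : {m : Fin 3 →₀ ℕ // m.degree = 6}, MvPolynomial.coeff m.1 f.1 •
      (⟨MvPolynomial.monomial m.1 1, MvPolynomial.isHomogeneous_monomial 1 m.2⟩ :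
        MvPolynomial.homogeneousSubmodule (Fin 3) k 6) := by
    apply Subtype.val_injective
    rw [Submodule.coe_sum]
    exact eq_sum_monomial_of_isHomogeneous f.2
  conv_lhs => rw [h]
  rw [map_sum, Finset.sum_apply, frameMap_apply]
  refine Finset.sum_congr rfl fun m _ => ?_
  rw [map_smul, Pi.smul_apply, smul_eq_mul, mul_comm]
  rfl

namespace LimitFamily

variable {k : Type*} [Field k] {z : Fin 6 → Fin 3 → k} {c : FrameIndex → k} {K : Type*} [Field K]
  [Algebra k K] (L : LimitFamily z c K)

/-- The moving points. -/
def point (j : Fin 6) : Fin 3 → K := L.G.mulVec fun l => algebraMap k K (z j l)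

/-- The inclusion of the ground field into the residue field. -/
def τ : k →+* IsLocalRing.ResidueField L.V := (IsLocalRing.residue L.V).comp L.ι

theorem frameMap_N {F : MvPolynomial (Fin 3) L.V} (hF : F.IsHomogeneous 6) (i : Fin 6) :
    (frameMap L.N F i : K) = ∑ j, L.H i j * MvPolynomial.aeval (L.point j) F := by
  have h : ∀ j, MvPolynomial.aeval (L.point j) F =
      ∑ m : {m : Fin 3 →₀ ℕ // m.degree = 6}, ((MvPolynomial.coeff m.1 F : L.V) : K) *
        MvPolynomial.aeval (L.point j) (MvPolynomial.monomial m.1 (1 : k)) := by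
    intro j
    conv_lhs => rw [eq_sum_monomial_of_isHomogeneous hF]
    rw [map_sum]
    refine Finset.sum_congr rfl fun m _ => ?_
    rw [map_smul, MvPolynomial.aeval_monomial, MvPolynomial.aeval_monomial, map_one, map_one]
    rfl
  rw [frameMap_apply]
  push_cast
  simp only [h, L.N_eq, pointFrame, Finset.sum_mul, Finset.mul_sum]
  rw [Finset.sum_comm]
  refine Finset.sum_congr rfl fun j _ => Finset.sum_congr rfl fun m _ => ?_
  rw [point]
  ring

theorem residue_frameMap_N {F : MvPolynomial (Fin 3) L.V} {f : MvPolynomial (Fin 3) k}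
    (h : MvPolynomial.map (IsLocalRing.residue L.V) F = MvPolynomial.map L.τ f) (i : Fin 6) :
    IsLocalRing.residue L.V (frameMap L.N F i) = L.τ (frameMap c f i) := by
  rw [map_frameMap, map_frameMap, h]
  simp only [L.residue_N]
  rfl

theorem map_residue_map_ι (f : MvPolynomial (Fin 3) k) :
    MvPolynomial.map (IsLocalRing.residue L.V) (MvPolynomial.map L.ι f) =
      MvPolynomial.map L.τ f := by
  rw [MvPolynomial.map_map]
  rfl

variable {M : PlaneSubscheme.HilbertFrame k 6} (L : LimitFamily z M.coords K)

/-- The reduction of a sextic through the moving points contains the limit subscheme. -/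
theorem mem_ideal_of_lift {F : MvPolynomial (Fin 3) L.V} (hF : F.IsHomogeneous 6)
    (hFz : ∀ j, MvPolynomial.aeval (L.point j) F = 0) {f : MvPolynomial (Fin 3) k}
    (hf : f.IsHomogeneous 6)
    (h : MvPolynomial.map (IsLocalRing.residue L.V) F = MvPolynomial.map L.τ f) :
    f ∈ M.scheme.ideal := by
  have h1 : (⟨f, hf⟩ : MvPolynomial.homogeneousSubmodule (Fin 3) k 6) ∈ LinearMap.ker M.map := by
    rw [LinearMap.mem_ker]
    ext i
    rw [M.map_apply_eq_frameMap]
    have h2 := L.residue_frameMap_N h i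
    have h3 : frameMap L.N F i = 0 := by
      apply Subtype.val_injective
      rw [L.frameMap_N hF i]
      simp [hFz]
    rw [h3, map_zero] at h2
    exact L.τ.injective (by rw [← h2, Pi.zero_apply, map_zero])
  rw [M.ker_eq] at h1
  exact h1

/-- Every sextic containing the limit subscheme lifts to a sextic through the moving points, because
the conditions to be met are linearly independent in the limit. -/
theorem exists_lift {f : MvPolynomial (Fin 3) k} (hf : f.IsHomogeneous 6)
    (hfM : f ∈ M.scheme.ideal) :
    ∃ F : MvPolynomial (Fin 3) L.V, F.IsHomogeneous 6 ∧
      (∀ j, MvPolynomial.aeval (L.point j) F = 0) ∧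
      MvPolynomial.map (IsLocalRing.residue L.V) F = MvPolynomial.map L.τ f := by
  have hbase : ∀ l : Fin 6, ∃ b : MvPolynomial.homogeneousSubmodule (Fin 3) k 6,
      M.map b = Pi.single l 1 := fun l => M.surjective _
  choose b hb using hbase
  have hbh : ∀ l, (MvPolynomial.map L.ι (b l).1).IsHomogeneous 6 := fun l =>
    MvPolynomial.IsHomogeneous.map (b l).2 _
  -- The values of the moving frame on lifts of a dual basis form an invertible matrix, so that a
  -- lift of `f` can be corrected by a combination of them.
  let A : Matrix (Fin 6) (Fin 6) L.V :=
    Matrix.of fun i l => frameMap L.N (MvPolynomial.map L.ι (b l).1) i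
  have hA : A.map (IsLocalRing.residue L.V) = 1 := by
    ext i l
    change IsLocalRing.residue L.V (frameMap L.N (MvPolynomial.map L.ι (b l).1) i) = _
    rw [L.residue_frameMap_N (L.map_residue_map_ι _),
      ← M.map_apply_eq_frameMap, hb, Matrix.one_apply, Pi.single_apply]
    simp
  have hAdet : IsUnit A.det := by
    have h1 : IsLocalRing.residue L.V A.det = 1 := by
      rw [RingHom.map_det, RingHom.mapMatrix_apply, hA, Matrix.det_one]
    by_contra hn
    rw [(IsLocalRing.residue_eq_zero_iff _).mpr hn] at h1
    exact zero_ne_one h1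
  let w := frameMap L.N (MvPolynomial.map L.ι f)
  have hw : ∀ i, IsLocalRing.residue L.V (w i) = 0 := by
    intro i
    have h1 : (⟨f, hf⟩ : MvPolynomial.homogeneousSubmodule (Fin 3) k 6) ∈ LinearMap.ker M.map := by
      rw [M.ker_eq]
      exact hfM
    rw [L.residue_frameMap_N (L.map_residue_map_ι f),
      ← M.map_apply_eq_frameMap (⟨f, hf⟩ : MvPolynomial.homogeneousSubmodule (Fin 3) k 6),
      LinearMap.mem_ker.mp h1, Pi.zero_apply, map_zero]
  let e := A⁻¹.mulVec w
  have he : ∀ l, IsLocalRing.residue L.V (e l) = 0 := by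
    intro l
    simp [e, Matrix.mulVec, dotProduct, hw]
  let F := MvPolynomial.map L.ι f - ∑ l, e l • MvPolynomial.map L.ι (b l).1
  have hF : F.IsHomogeneous 6 := by
    refine (MvPolynomial.IsHomogeneous.map hf _).sub
      (MvPolynomial.IsHomogeneous.sum _ _ _ fun l _ => ?_)
    rw [MvPolynomial.smul_eq_C_mul]
    exact (hbh l).C_mul (e l)
  refine ⟨F, hF, ?_, ?_⟩
  · have h0 : frameMap L.N F = 0 := by
      have h1 : frameMap L.N F = w - A.mulVec e := by
        ext i
        simp only [F, map_sub, map_sum, map_smul, Pi.sub_apply, Finset.sum_apply, Pi.smul_apply,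
          smul_eq_mul, Matrix.mulVec, dotProduct, A, Matrix.of_apply, w, mul_comm]
      rw [h1, Matrix.mulVec_mulVec, Matrix.mul_nonsing_inv _ hAdet, Matrix.one_mulVec, sub_self]
    have h2 : L.H.mulVec (fun j => MvPolynomial.aeval (L.point j) F) = 0 := by
      ext i
      have h3 := L.frameMap_N hF i
      rw [h0] at h3
      exact h3.symm
    have h4 := Matrix.eq_zero_of_mulVec_eq_zero L.isUnit_det_H.ne_zero h2
    exact fun j => congrFun h4 j
  · simp only [F, map_sub, map_sum, MvPolynomial.smul_eq_C_mul, map_mul, MvPolynomial.map_C, he,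
      map_zero, zero_mul, Finset.sum_const_zero, sub_zero, L.map_residue_map_ι]

end LimitFamily

end Specialization

/-! ### Tangent forms and forms of degree six through a subscheme -/

section Gradient

variable {k : Type*} [Field k]

/-- The gradient of a polynomial at (the chosen representative of) a point of the plane. -/
def formGradient (x : ℙ k (Fin 3 → k)) (f : MvPolynomial (Fin 3) k) : Fin 3 → k :=
  fun i => MvPolynomial.eval x.rep (MvPolynomial.pderiv i f)

theorem formGradient_add (x : ℙ k (Fin 3 → k)) (f g : MvPolynomial (Fin 3) k) :
    formGradient x (f + g) = formGradient x f + formGradient x g := by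
  ext i
  simp [formGradient]

theorem formGradient_sub (x : ℙ k (Fin 3 → k)) (f g : MvPolynomial (Fin 3) k) :
    formGradient x (f - g) = formGradient x f - formGradient x g := by
  ext i
  simp [formGradient]

theorem formGradient_sum (x : ℙ k (Fin 3 → k)) {α : Type*} (s : Finset α)
    (f : α → MvPolynomial (Fin 3) k) :
    formGradient x (∑ i ∈ s, f i) = ∑ i ∈ s, formGradient x (f i) := by
  ext i
  simp [formGradient]

theorem formGradient_mul (x : ℙ k (Fin 3 → k)) (f g : MvPolynomial (Fin 3) k) :
    formGradient x (f * g) = MvPolynomial.eval x.rep f • formGradient x g +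
      MvPolynomial.eval x.rep g • formGradient x f := by
  ext i
  simp [formGradient]

theorem formGradient_mul_of_eval_eq_zero {x : ℙ k (Fin 3 → k)} {f : MvPolynomial (Fin 3) k}
    (hf : MvPolynomial.eval x.rep f = 0) (g : MvPolynomial (Fin 3) k) :
    formGradient x (g * f) = MvPolynomial.eval x.rep g • formGradient x f := by
  rw [formGradient_mul, hf, zero_smul, add_zero]

theorem formGradient_linForm (x : ℙ k (Fin 3 → k)) (a : Fin 3 → k) :
    formGradient x (linForm a) = a := by
  ext i
  simp only [formGradient, linForm, map_sum, MvPolynomial.pderiv_C_mul]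
  rw [Finset.sum_eq_single i]
  · simp
  · intro l _ hl
    simp [MvPolynomial.pderiv_X_of_ne hl]
  · simp

theorem formGradient_eq_zero_of_mem_sq {x : ℙ k (Fin 3 → k)} {f : MvPolynomial (Fin 3) k}
    (hf : f ∈ pointIdeal x ^ 2) : formGradient x f = 0 := by
  rw [pow_two] at hf
  refine Submodule.mul_induction_on hf (fun a ha b hb => ?_) fun a b ha hb => ?_
  · rw [formGradient_mul, eval_eq_zero_of_mem_pointIdeal ha, eval_eq_zero_of_mem_pointIdeal hb,
      zero_smul, zero_smul, add_zero]
  · rw [formGradient_add, ha, hb, add_zero]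

/-- Euler's identity. -/
theorem formGradient_dotProduct_rep {x : ℙ k (Fin 3 → k)} {f : MvPolynomial (Fin 3) k} {d : ℕ}
    (hf : f.IsHomogeneous d) (hfx : MvPolynomial.eval x.rep f = 0) :
    formGradient x f ⬝ᵥ x.rep = 0 := by
  have h := congrArg (MvPolynomial.eval x.rep) hf.sum_X_mul_pderiv
  rw [map_nsmul, hfx, smul_zero] at h
  simpa [formGradient, dotProduct, mul_comm] using h

namespace PlaneSubscheme

variable {n : ℕ} (W : PlaneSubscheme k n) {r : ℙ k (Fin 3 → k)}

theorem exists_form_of_notMem_tangentSpace {p : ℙ k (Fin 3 → k)} (hp : p ∉ W.tangentSpace r) :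
    ∃ (d : ℕ) (f : MvPolynomial (Fin 3) k), f.IsHomogeneous d ∧ f ∈ W.ideal ∧
      formGradient r f ⬝ᵥ p.rep ≠ 0 := by
  rw [tangentSpace, Set.mem_ofPred_eq] at hp
  push Not at hp
  obtain ⟨f, hf, hne⟩ := hp
  change formGradient r f ⬝ᵥ p.rep ≠ 0 at hne
  by_contra hcon
  push Not at hcon
  apply hne
  rw [← MvPolynomial.sum_homogeneousComponent f, formGradient_sum, sum_dotProduct]
  exact Finset.sum_eq_zero fun d _ => hcon d _
    (MvPolynomial.homogeneousComponent_isHomogeneous d f) (W.homogeneousComponent_mem hf d)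

/-- Two points off the tangent space are off the tangent line of one and the same form. -/
theorem exists_form_of_notMem_tangentSpace₂ {p q : ℙ k (Fin 3 → k)} (hr : W.ideal ≤ pointIdeal r)
    (hp : p ∉ W.tangentSpace r) (hq : q ∉ W.tangentSpace r) :
    ∃ (d : ℕ) (f : MvPolynomial (Fin 3) k), f.IsHomogeneous d ∧ f ∈ W.ideal ∧
      formGradient r f ⬝ᵥ p.rep ≠ 0 ∧ formGradient r f ⬝ᵥ q.rep ≠ 0 := by
  obtain ⟨d, f, hf, hfW, hfp⟩ := W.exists_form_of_notMem_tangentSpace hp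
  obtain ⟨e, g, hg, hgW, hgq⟩ := W.exists_form_of_notMem_tangentSpace hq
  by_cases hfq : formGradient r f ⬝ᵥ q.rep = 0
  · by_cases hgp : formGradient r g ⬝ᵥ p.rep = 0
    · -- A sum of multiples of the two forms of a common degree.
      obtain ⟨i, hi⟩ := exists_rep_ne_zero r
      have hX := MvPolynomial.isHomogeneous_X k i
      have hgrad : formGradient r (MvPolynomial.X i ^ e * f + MvPolynomial.X i ^ d * g) =
          r.rep i ^ e • formGradient r f + r.rep i ^ d • formGradient r g := by
        rw [formGradient_add,
          formGradient_mul_of_eval_eq_zero (eval_eq_zero_of_mem_pointIdeal (hr hfW)),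
          formGradient_mul_of_eval_eq_zero (eval_eq_zero_of_mem_pointIdeal (hr hgW))]
        simp
      have h1 : (MvPolynomial.X i ^ e * f).IsHomogeneous (e + d) := by
        simpa using (hX.pow e).mul hf
      have h2 : (MvPolynomial.X i ^ d * g).IsHomogeneous (e + d) := by
        simpa [add_comm] using (hX.pow d).mul hg
      refine ⟨e + d, _, h1.add h2,
        W.ideal.add_mem (W.ideal.mul_mem_left _ hfW) (W.ideal.mul_mem_left _ hgW), ?_, ?_⟩
      · rw [hgrad, add_dotProduct, smul_dotProduct, smul_dotProduct, hgp, smul_zero, add_zero]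
        exact smul_ne_zero (pow_ne_zero _ hi) hfp
      · rw [hgrad, add_dotProduct, smul_dotProduct, smul_dotProduct, hfq, smul_zero, zero_add]
        exact smul_ne_zero (pow_ne_zero _ hi) hgq
    · exact ⟨e, g, hg, hgW, hgp, hgq⟩
  · exact ⟨d, f, hf, hfW, hfp, hfq⟩

/-- At a point of multiplicity at most four, the products of at least four linear forms through the
point vanish on `W`. -/
theorem pow_mul_pow_mem (h : W.multiplicity r ≤ 4) {l₁ l₂ : MvPolynomial (Fin 3) k}
    (hl₁ : l₁.IsHomogeneous 1) (hl₂ : l₂.IsHomogeneous 1) (h₁ : l₁ ∈ pointIdeal r)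
    (h₂ : l₂ ∈ pointIdeal r) {a b : ℕ} (hab : 4 ≤ a + b) :
    l₁ ^ a * l₂ ^ b ∈ locIdeal W.ideal r ⊓ pointIdeal r ^ 2 := by
  let l : ℕ → MvPolynomial (Fin 3) k := fun i => if i < a then l₁ else l₂
  have hprod : l₁ ^ a * l₂ ^ b = ∏ i ∈ Finset.range (a + b), l i := by
    rw [Finset.prod_range_add, Finset.prod_congr rfl (g := fun _ => l₁), Finset.prod_const,
      Finset.card_range]
    · simp [l]
    · intro i hi
      exact if_pos (Finset.mem_range.mp hi)
  have hl : ∀ i, (l i).IsHomogeneous 1 := fun i => by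
    simp only [l]
    split_ifs <;> assumption
  have hlr : ∀ i, l i ∈ pointIdeal r := fun i => by
    simp only [l]
    split_ifs <;> assumption
  rw [hprod]
  obtain ⟨c, hc⟩ := Finset.prod_dvd_prod_of_subset _ _ l (Finset.range_subset_range.mpr hab)
  rw [hc]
  refine Ideal.mul_mem_right _ _ ⟨W.prod_mem_locIdeal (m := 4) h l hl hlr, ?_⟩
  have h4 : ∏ i ∈ Finset.range 4, l i ∈ ∏ _i ∈ Finset.range 4, pointIdeal r :=
    Ideal.prod_mem_prod fun i _ => hlr i
  rw [Finset.prod_const, Finset.card_range] at h4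
  exact Ideal.pow_le_pow_right (by norm_num) h4

/-- Near a point of multiplicity at most four, every form agrees on `W` with a cubic form, up to
powers of a linear form not vanishing at the point: drop the terms of order at least four. -/
theorem exists_cubic (h : W.multiplicity r ≤ 4) (B : GL (Fin 3) k)
    (hB : ∀ i, B.val i 0 = r.rep i) {d : ℕ} {f : MvPolynomial (Fin 3) k}
    (hf : f.IsHomogeneous d) :
    ∃ g : MvPolynomial (Fin 3) k, g.IsHomogeneous 3 ∧
      linForm (B⁻¹.val 0) ^ 3 * f - linForm (B⁻¹.val 0) ^ d * g ∈
        locIdeal W.ideal r ⊓ pointIdeal r ^ 2 := by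
  have hl : ∀ i, (linForm (B⁻¹.val i)).IsHomogeneous 1 := fun i => linForm_isHomogeneous _
  have hl₁ : linForm (B⁻¹.val 1) ∈ pointIdeal r := by
    rw [linForm_mem_pointIdeal_iff, inv_row_dotProduct_column B hB]
    simp
  have hl₂ : linForm (B⁻¹.val 2) ∈ pointIdeal r := by
    rw [linForm_mem_pointIdeal_iff, inv_row_dotProduct_column B hB]
    simp
  have hmono : ∀ m : Fin 3 →₀ ℕ, m 0 + m 1 + m 2 = d →
      ∃ g : MvPolynomial (Fin 3) k, g.IsHomogeneous 3 ∧
      linForm (B⁻¹.val 0) ^ 3 * linearSubst B⁻¹ (MvPolynomial.monomial m 1) -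
        linForm (B⁻¹.val 0) ^ d * g ∈ locIdeal W.ideal r ⊓ pointIdeal r ^ 2 := by
    intro m hm
    have hmon : linearSubst B⁻¹ (MvPolynomial.monomial m 1) =
        linForm (B⁻¹.val 0) ^ m 0 * (linForm (B⁻¹.val 1) ^ m 1 * linForm (B⁻¹.val 2) ^ m 2) := by
      rw [MvPolynomial.monomial_eq, Finsupp.prod_fintype _ _ (by simp), Fin.prod_univ_three]
      simp only [map_mul, map_pow, linearSubst_X_eq_linForm, map_one]
      ring
    rw [hmon]
    by_cases h4 : 4 ≤ m 1 + m 2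
    · refine ⟨0, MvPolynomial.isHomogeneous_zero _ _ _, ?_⟩
      rw [mul_zero, sub_zero, ← mul_assoc]
      exact Ideal.mul_mem_left _ _ (W.pow_mul_pow_mem h (hl 1) (hl 2) hl₁ hl₂ h4)
    · refine ⟨linForm (B⁻¹.val 0) ^ (3 - m 1 - m 2) *
        (linForm (B⁻¹.val 1) ^ m 1 * linForm (B⁻¹.val 2) ^ m 2), ?_, ?_⟩
      · have h1 := ((hl 0).pow (3 - m 1 - m 2)).mul (((hl 1).pow (m 1)).mul ((hl 2).pow (m 2)))
        rwa [show 1 * (3 - m 1 - m 2) + (1 * m 1 + 1 * m 2) = 3 by omega] at h1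
      · have e : ∀ A Y : MvPolynomial (Fin 3) k,
            A ^ 3 * (A ^ m 0 * Y) = A ^ d * (A ^ (3 - m 1 - m 2) * Y) := fun A Y => by
          rw [← mul_assoc, ← pow_add, ← mul_assoc, ← pow_add,
            show 3 + m 0 = d + (3 - m 1 - m 2) by omega]
        rw [e, sub_self]
        exact Ideal.zero_mem _
  choose! g hg hgm using hmono
  obtain ⟨s, c, hs, rfl⟩ : ∃ (s : Finset (Fin 3 →₀ ℕ)) (c : (Fin 3 →₀ ℕ) → k),
      (∀ m ∈ s, m 0 + m 1 + m 2 = d) ∧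
      f = ∑ m ∈ s, MvPolynomial.C (c m) * linearSubst B⁻¹ (MvPolynomial.monomial m 1) := by
    refine ⟨(linearSubst B f).support, fun m => MvPolynomial.coeff m (linearSubst B f),
      fun m hm => sum_exponents_eq (linearSubst_isHomogeneous B hf) hm, ?_⟩
    have h1 := linearSubst_inv_apply B⁻¹ f
    rw [inv_inv] at h1
    conv_lhs => rw [← h1, (linearSubst B f).as_sum, map_sum]
    refine Finset.sum_congr rfl fun m _ => ?_
    rw [← linearSubst_C B⁻¹, ← map_mul, MvPolynomial.C_mul_monomial, mul_one]
  refine ⟨∑ m ∈ s, MvPolynomial.C (c m) * g m,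
    MvPolynomial.IsHomogeneous.sum _ _ _ fun m hm => (hg m (hs m hm)).C_mul _, ?_⟩
  rw [Finset.mul_sum, Finset.mul_sum, ← Finset.sum_sub_distrib]
  refine Ideal.sum_mem _ fun m hm => ?_
  rw [mul_left_comm, mul_left_comm _ (MvPolynomial.C (c m)), ← mul_sub]
  exact Ideal.mul_mem_left _ _ (hgm m (hs m hm))

end PlaneSubscheme

end Gradient

/-! ### Subschemes with cycle `p + q + 4r` -/

section Cycle

variable {k : Type*} [Field k]

theorem exists_coordinates_at (x : ℙ k (Fin 3 → k)) :
    ∃ B : GL (Fin 3) k, ∀ i, B.val i 0 = x.rep i := by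
  obtain ⟨a, p, ha, hp⟩ := exists_linForm_vanishing x.rep_nonzero
  obtain ⟨B, hB, -⟩ := exists_coordinates x.rep_nonzero ha hp
  exact ⟨B, hB⟩

namespace PlaneSubscheme

variable {n : ℕ} {W : PlaneSubscheme k n} {p q r : ℙ k (Fin 3 → k)}

/-- The multiplicities of `W` are those of the cycle `p + q + 4r` with `r` different from `p` and
`q`; the case `p = q` is allowed. -/
structure HasQuadruplePoint (W : PlaneSubscheme k n) (p q r : ℙ k (Fin 3 → k)) : Prop where
  p_ne : p ≠ r
  q_ne : q ≠ r
  cycle : W.HasCycle (Finsupp.single p 1 + Finsupp.single q 1 + Finsupp.single r 4)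

namespace HasQuadruplePoint

theorem symm (h : W.HasQuadruplePoint p q r) : W.HasQuadruplePoint q p r :=
  ⟨h.q_ne, h.p_ne, by simpa only [add_comm (Finsupp.single q 1)] using h.cycle⟩

theorem multiplicity_r (h : W.HasQuadruplePoint p q r) : W.multiplicity r = 4 := by
  rw [h.cycle r]
  simp [h.p_ne, h.q_ne]

theorem multiplicity_p_of_eq (h : W.HasQuadruplePoint p p r) : W.multiplicity p = 2 := by
  rw [h.cycle p]
  simp [h.p_ne.symm]

theorem multiplicity_p_of_ne (h : W.HasQuadruplePoint p q r) (hpq : p ≠ q) :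
    W.multiplicity p = 1 := by
  rw [h.cycle p]
  simp [h.p_ne.symm, hpq.symm]

theorem multiplicity_other (h : W.HasQuadruplePoint p q r) {y : ℙ k (Fin 3 → k)} (hp : y ≠ p)
    (hq : y ≠ q) (hr : y ≠ r) : W.multiplicity y = 0 := by
  rw [h.cycle y]
  simp [hp.symm, hq.symm, hr.symm]

theorem mul_mem_locIdeal_p (h : W.HasQuadruplePoint p q r) {l l' : MvPolynomial (Fin 3) k}
    (hl : l.IsHomogeneous 1) (hl' : l'.IsHomogeneous 1) (hlp : l ∈ pointIdeal p)
    (hlq : l' ∈ pointIdeal q) : l * l' ∈ locIdeal W.ideal p := by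
  by_cases hpq : p = q
  · subst hpq
    have h1 := W.prod_mem_locIdeal (m := 2) h.multiplicity_p_of_eq.le
      (fun i => if i = 0 then l else l') (fun i => by split_ifs <;> assumption)
      (fun i => by split_ifs <;> assumption)
    simpa [Finset.prod_range_succ] using h1
  · have h1 := W.prod_mem_locIdeal (m := 1) (h.multiplicity_p_of_ne hpq).le (fun _ => l)
      (fun _ => hl) (fun _ => hlp)
    exact Ideal.mul_mem_right _ _ (by simpa using h1)

/-- A form which near `r` lies in the ideal of `W` lies in that ideal after multiplication by linear
forms through `p` and `q`. -/
theorem mul_mem_ideal [IsAlgClosed k] (h : W.HasQuadruplePoint p q r)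
    {f l l' : MvPolynomial (Fin 3) k} {d : ℕ} (hf : f.IsHomogeneous d)
    (hfr : f ∈ locIdeal W.ideal r) (hl : l.IsHomogeneous 1) (hl' : l'.IsHomogeneous 1)
    (hlp : l ∈ pointIdeal p) (hlq : l' ∈ pointIdeal q) : f * (l * l') ∈ W.ideal := by
  refine W.mem_of_forall_mem_locIdeal (hf.mul (hl.mul hl')) fun y => ?_
  by_cases hyr : y = r
  · subst hyr
    exact Ideal.mul_mem_right _ _ hfr
  refine Ideal.mul_mem_left _ _ ?_
  by_cases hyp : y = p
  · subst hyp
    exact h.mul_mem_locIdeal_p hl hl' hlp hlq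
  by_cases hyq : y = q
  · subst hyq
    rw [mul_comm]
    exact h.symm.mul_mem_locIdeal_p hl' hl hlq hlp
  have h2 : (1 : MvPolynomial (Fin 3) k) ∈ locIdeal W.ideal y := by
    have h0 := W.prod_mem_locIdeal (x := y) (m := 0) (h.multiplicity_other hyp hyq hyr).le
      (fun _ => 0) (fun _ => MvPolynomial.isHomogeneous_zero _ _ _) fun _ => Ideal.zero_mem _
    simpa using h0
  rw [(Ideal.eq_top_iff_one _).mpr h2]
  trivial

/-- Every tangent direction at `r` of a form in the ideal of `W` is that of a form of degree six in
the ideal: multiply a cubic that agrees with the given form near `r` by lines through `p` and `q`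
and by a line avoiding `r`. -/
theorem exists_sextic [IsAlgClosed k] (h : W.HasQuadruplePoint p q r)
    {f : MvPolynomial (Fin 3) k} {d : ℕ} (hf : f.IsHomogeneous d) (hfW : f ∈ W.ideal) :
    ∃ (g : MvPolynomial (Fin 3) k) (c : k), g.IsHomogeneous 6 ∧ g ∈ W.ideal ∧ c ≠ 0 ∧
      formGradient r g = c • formGradient r f := by
  obtain ⟨B, hB⟩ := exists_coordinates_at r
  obtain ⟨g, hg, hmem⟩ := W.exists_cubic h.multiplicity_r.le B hB hf
  have hr : W.ideal ≤ pointIdeal r := W.ideal_le_pointIdeal (by rw [h.multiplicity_r]; simp)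
  have hl₀ : MvPolynomial.eval r.rep (linForm (B⁻¹.val 0)) = 1 := by
    rw [eval_linForm, inv_row_dotProduct_column B hB]
    simp
  have hl₀r : ∀ m : ℕ, linForm (B⁻¹.val 0) ^ m ∉ pointIdeal r := fun m hm => by
    have := eval_eq_zero_of_mem_pointIdeal hm
    rw [map_pow, hl₀, one_pow] at this
    exact one_ne_zero this
  have hgloc : g ∈ locIdeal W.ideal r := by
    refine mem_locIdeal_of_mul_mem (hl₀r d) ?_
    have h1 := Ideal.sub_mem _
      (Ideal.mul_mem_left _ (linForm (B⁻¹.val 0) ^ 3) (le_locIdeal _ r hfW)) hmem.1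
    simpa using h1
  have hgr : g ∈ pointIdeal r := by
    obtain ⟨s, hs, hsg⟩ := mem_locIdeal.mp hgloc
    exact ((pointIdeal_isPrime r).mem_or_mem (hr hsg)).resolve_left hs
  have hgrad : formGradient r g = formGradient r f := by
    have h1 := formGradient_eq_zero_of_mem_sq hmem.2
    rw [formGradient_sub, formGradient_mul_of_eval_eq_zero (eval_eq_zero_of_mem_pointIdeal hgr),
      formGradient_mul_of_eval_eq_zero (eval_eq_zero_of_mem_pointIdeal (hr hfW)), map_pow,
      map_pow, hl₀, one_pow, one_pow, one_smul, one_smul, sub_eq_zero] at h1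
    exact h1.symm
  obtain ⟨a, hap, har⟩ := exists_linForm_separating h.p_ne
  obtain ⟨b, hbq, hbr⟩ := exists_linForm_separating h.q_ne
  refine ⟨(linForm (B⁻¹.val 0) * g) * (linForm a * linForm b), (a ⬝ᵥ r.rep) * (b ⬝ᵥ r.rep),
    ((linForm_isHomogeneous _).mul hg).mul
      ((linForm_isHomogeneous _).mul (linForm_isHomogeneous _)),
    h.mul_mem_ideal ((linForm_isHomogeneous _).mul hg) (Ideal.mul_mem_left _ _ hgloc)
      (linForm_isHomogeneous _) (linForm_isHomogeneous _)
      (linForm_mem_pointIdeal_iff.mpr hap) (linForm_mem_pointIdeal_iff.mpr hbq),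
    mul_ne_zero har hbr, ?_⟩
  rw [show linForm (B⁻¹.val 0) * g * (linForm a * linForm b) =
    linForm (B⁻¹.val 0) * (linForm a * linForm b) * g by ring,
    formGradient_mul_of_eval_eq_zero (eval_eq_zero_of_mem_pointIdeal hgr), hgrad]
  simp only [map_mul, hl₀, eval_linForm, one_mul]

/-- A product of linear forms through `p`, `q` and four times `r` contains `W`. -/
theorem prod_linForm_mem_ideal [IsAlgClosed k] (h : W.HasQuadruplePoint p q r) {a b c : Fin 3 → k}
    (ha : a ⬝ᵥ p.rep = 0) (hb : b ⬝ᵥ q.rep = 0) (hc : c ⬝ᵥ r.rep = 0) :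
    linForm c ^ 4 * (linForm a * linForm b) ∈ W.ideal := by
  refine h.mul_mem_ideal ((linForm_isHomogeneous c).pow 4) ?_ (linForm_isHomogeneous _)
    (linForm_isHomogeneous _) (linForm_mem_pointIdeal_iff.mpr ha)
    (linForm_mem_pointIdeal_iff.mpr hb)
  have h1 := W.prod_mem_locIdeal (m := 4) h.multiplicity_r.le (fun _ => linForm c)
    (fun _ => linForm_isHomogeneous _) (fun _ => linForm_mem_pointIdeal_iff.mpr hc)
  simpa using h1

end HasQuadruplePoint

open Classical in
/-- If the products of linear forms through the points `x 0`, …, `x 5` contain `W`, then locally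
at a point `y` so does the power of a linear form through `y` with exponent the number of
occurrences of `y`. -/
theorem pow_card_mem_locIdeal {x : Fin 6 → ℙ k (Fin 3 → k)}
    (hx : ∀ a : Fin 6 → Fin 3 → k, (∀ j, a j ⬝ᵥ (x j).rep = 0) → ∏ j, linForm (a j) ∈ W.ideal)
    {y : ℙ k (Fin 3 → k)} {a : Fin 3 → k} (ha : a ⬝ᵥ y.rep = 0) :
    linForm a ^ (Finset.univ.filter fun j => x j = y).card ∈ locIdeal W.ideal y := by
  have hsep : ∀ j, ∃ b : Fin 3 → k, b ⬝ᵥ (x j).rep = 0 ∧ (x j ≠ y → b ⬝ᵥ y.rep ≠ 0) := by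
    intro j
    by_cases hj : x j = y
    · exact ⟨0, by simp, fun h => absurd hj h⟩
    · obtain ⟨b, hb, hb'⟩ := exists_linForm_separating hj
      exact ⟨b, hb, fun _ => hb'⟩
  choose b hb hb' using hsep
  have h1 := hx (fun j => if x j = y then a else b j) fun j => by
    by_cases hj : x j = y
    · simpa [hj] using ha
    · simpa [hj] using hb j
  rw [← Finset.prod_filter_mul_prod_filter_not Finset.univ (fun j => x j = y),
    Finset.prod_congr rfl (g := fun _ => linForm a), Finset.prod_const, mul_comm] at h1
  · refine mem_locIdeal.mpr ⟨_, fun hmem => ?_, h1⟩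
    rw [(pointIdeal_isPrime y).prod_mem_iff] at hmem
    obtain ⟨j, hj, hjm⟩ := hmem
    have hjy := (Finset.mem_filter.mp hj).2
    rw [if_neg hjy, linForm_mem_pointIdeal_iff] at hjm
    exact hb' j hjy hjm
  · intro j hj
    rw [if_pos (Finset.mem_filter.mp hj).2]

open Classical in
/-- At a point where a curve containing `W` is smooth, the multiplicity of `W` is at most the number
of occurrences of the point. -/
theorem multiplicity_le_card {x : Fin 6 → ℙ k (Fin 3 → k)}
    (hx : ∀ a : Fin 6 → Fin 3 → k, (∀ j, a j ⬝ᵥ (x j).rep = 0) → ∏ j, linForm (a j) ∈ W.ideal)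
    {y : ℙ k (Fin 3 → k)} {f : MvPolynomial (Fin 3) k} {d : ℕ} (hf : f.IsHomogeneous d)
    (hfW : f ∈ locIdeal W.ideal y) (hfy : f ∈ pointIdeal y) (hgrad : formGradient y f ≠ 0) :
    W.multiplicity y ≤ (Finset.univ.filter fun j => x j = y).card := by
  obtain ⟨i, hi⟩ : ∃ i, formGradient y f i ≠ 0 := Function.ne_iff.mp hgrad
  have hgy := formGradient_dotProduct_rep hf (eval_eq_zero_of_mem_pointIdeal hfy)
  obtain ⟨B, hB0, hB2, hB1⟩ := exists_coordinates (p := Pi.single i 1) y.rep_nonzero hgy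
    (by simpa using hi)
  have hl : ∀ e, B⁻¹.val e ⬝ᵥ y.rep = (1 : Matrix (Fin 3) (Fin 3) k) e 0 :=
    inv_row_dotProduct_column B hB0
  cases d with
  | zero =>
    exfalso
    rw [MvPolynomial.totalDegree_eq_zero_iff_eq_C.mp
      ((MvPolynomial.totalDegree_zero_iff_isHomogeneous (Fin 3)).mpr hf)] at hi
    simp [formGradient] at hi
  | succ d =>
  obtain ⟨f₁, f₂, hf₁, hf₂, hff⟩ := exists_decomposition_of_vanishing B hf (by
    rw [funext hB0]
    exact eval_eq_zero_of_mem_pointIdeal hfy)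
  refine W.multiplicity_le B hB0 hfW hf₁ hf₂ hff (fun hf₂y => hi ?_)
    (pow_card_mem_locIdeal hx (by rw [hl]; simp))
  have h1 : formGradient y f = MvPolynomial.eval y.rep f₁ • B⁻¹.val 1 := by
    rw [hff, formGradient_add, formGradient_mul, formGradient_mul, formGradient_linForm,
      formGradient_linForm, eval_linForm, eval_linForm, hl, hl,
      eval_eq_zero_of_mem_pointIdeal hf₂y]
    simp
  -- The gradient would be a multiple of a coordinate which vanishes at the last basis vector.
  have h2 : B⁻¹.val 1 i = 0 := by
    have := inv_row_dotProduct_column B (v := Pi.single i 1) hB2 1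
    simpa using this
  rw [h1, Pi.smul_apply, h2, smul_zero]

open Classical in
/-- If a point occurs at most once, a line through it serves as the smooth curve. -/
theorem multiplicity_le_card_of_card_le_one {x : Fin 6 → ℙ k (Fin 3 → k)}
    (hx : ∀ a : Fin 6 → Fin 3 → k, (∀ j, a j ⬝ᵥ (x j).rep = 0) → ∏ j, linForm (a j) ∈ W.ideal)
    {y : ℙ k (Fin 3 → k)} (hy : (Finset.univ.filter fun j => x j = y).card ≤ 1) :
    W.multiplicity y ≤ (Finset.univ.filter fun j => x j = y).card := by
  obtain ⟨a, p, ha, hap⟩ := exists_linForm_vanishing y.rep_nonzero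
  refine multiplicity_le_card hx (linForm_isHomogeneous a) ?_ (linForm_mem_pointIdeal_iff.mpr ha) ?_
  · obtain ⟨c, hc⟩ := pow_dvd_pow (linForm a) hy
    rw [pow_one] at hc
    rw [hc]
    exact Ideal.mul_mem_right _ _ (pow_card_mem_locIdeal hx ha)
  · rw [formGradient_linForm]
    rintro rfl
    simp at hap

open Classical in
/-- If the products of linear forms through six points contain `W`, then at least three of the
points are `r` and two of them are `p` or `q`. -/
theorem HasQuadruplePoint.exists_indices (h : W.HasQuadruplePoint p q r)
    {x : Fin 6 → ℙ k (Fin 3 → k)}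
    (hx : ∀ a : Fin 6 → Fin 3 → k, (∀ j, a j ⬝ᵥ (x j).rep = 0) → ∏ j, linForm (a j) ∈ W.ideal)
    {f : MvPolynomial (Fin 3) k} {d : ℕ} (hf : f.IsHomogeneous d) (hfW : f ∈ W.ideal)
    (hgrad : formGradient r f ≠ 0) :
    (∃ s : Fin 3 → Fin 6, Function.Injective s ∧ ∀ i, x (s i) = r) ∧
    ∃ t : Fin 2 → Fin 6, Function.Injective t ∧ ∀ i, x (t i) = p ∨ x (t i) = q := by
  constructor
  · have h4 : W.multiplicity r ≤ (Finset.univ.filter fun j => x j = r).card :=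
      multiplicity_le_card hx hf (le_locIdeal _ r hfW)
        (W.ideal_le_pointIdeal (by rw [h.multiplicity_r]; simp) hfW) hgrad
    rw [h.multiplicity_r] at h4
    have h4' : 4 ≤ (Finset.univ.filter fun j => x j = r).card := by exact_mod_cast h4
    obtain ⟨u, hu, huc⟩ := Finset.exists_subset_card_eq ((by omega : 3 ≤ 4).trans h4')
    exact ⟨u.orderEmbOfFin huc, (u.orderEmbOfFin huc).injective, fun i =>
      (Finset.mem_filter.mp (hu (u.orderEmbOfFin_mem huc i))).2⟩
  · by_cases hpq : p = q
    · subst hpq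
      have h2 : 2 ≤ (Finset.univ.filter fun j => x j = p).card := by
        by_contra hlt
        have hle := multiplicity_le_card_of_card_le_one hx (y := p) (by omega)
        rw [h.multiplicity_p_of_eq] at hle
        have : 2 ≤ (Finset.univ.filter fun j => x j = p).card := by exact_mod_cast hle
        omega
      obtain ⟨u, hu, huc⟩ := Finset.exists_subset_card_eq h2
      exact ⟨u.orderEmbOfFin huc, (u.orderEmbOfFin huc).injective, fun i =>
        Or.inl (Finset.mem_filter.mp (hu (u.orderEmbOfFin_mem huc i))).2⟩
    · have key : ∀ y, W.multiplicity y = 1 → ∃ j, x j = y := by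
        intro y hy
        by_contra hcon
        push Not at hcon
        have h0 : (Finset.univ.filter fun j => x j = y).card = 0 := by
          rw [Finset.card_eq_zero, Finset.filter_eq_empty_iff]
          exact fun j _ => hcon j
        have hle := multiplicity_le_card_of_card_le_one hx (y := y) (by omega)
        rw [h0, hy] at hle
        simp at hle
      obtain ⟨a, ha⟩ := key p (h.multiplicity_p_of_ne hpq)
      obtain ⟨b, hb⟩ := key q (h.symm.multiplicity_p_of_ne (Ne.symm hpq))
      refine ⟨![a, b], fun i j hij => ?_, fun i => ?_⟩
      · have hab : a ≠ b := by
          rintro rfl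
          exact hpq (ha.symm.trans hb)
        fin_cases i <;> fin_cases j <;> first | rfl | exact absurd hij hab |
          exact absurd hij.symm hab
      · fin_cases i
        · exact Or.inl ha
        · exact Or.inr hb

end PlaneSubscheme

end Cycle

/-! ### The limits of the moving points -/

namespace LimitFamily

variable {k : Type*} [Field k] {z : Fin 6 → Fin 3 → k} {c : FrameIndex → k} {K : Type*} [Field K]
  [Algebra k K]

theorem point_ne_zero (L : LimitFamily z c K) {j : Fin 6} (hz : z j ≠ 0) : L.point j ≠ 0 := by
  intro h
  have h1 := Matrix.eq_zero_of_mulVec_eq_zero L.isUnit_det_G.ne_zero h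
  apply hz
  ext l
  exact (algebraMap k K).injective ((congrFun h1 l).trans (map_zero _).symm)

/-- The pullback along the moving matrix of the linear form with constant coefficients `β`. -/
def movedForm (L : LimitFamily z c K) (β : Fin 3 → k) : Fin 3 → K :=
  Matrix.vecMul (fun e => algebraMap k K (β e)) L.G

theorem movedForm_dotProduct (L : LimitFamily z c K) (β : Fin 3 → k) (j : Fin 6) :
    (L.movedForm β ⬝ᵥ fun l => algebraMap k K (z j l)) =
      (fun e => algebraMap k K (β e)) ⬝ᵥ L.point j := by
  rw [movedForm, point, Matrix.dotProduct_mulVec]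

/-- The vector `η` is a primitive multiple of the `j`-th moving point, with scalar `b`, and its
reduction represents the point `x` of the plane. -/
structure IsLimitPoint (L : LimitFamily z c K) (j : Fin 6) (b : K) (η : Fin 3 → L.V)
    (x : ℙ k (Fin 3 → k)) : Prop where
  ne_zero : b ≠ 0
  exists_eq_one : ∃ i, η i = 1
  point_eq : ∀ l, L.point j l = b * η l
  dotProduct_eq_zero : ∀ a : Fin 3 → k, a ⬝ᵥ x.rep = 0 →
    (fun i => L.τ (a i)) ⬝ᵥ (fun l => IsLocalRing.residue L.V (η l)) = 0

namespace IsLimitPoint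

variable {L : LimitFamily z c K} {j : Fin 6} {b : K} {η : Fin 3 → L.V} {x : ℙ k (Fin 3 → k)}

theorem dotProduct_ne_zero (h : L.IsLimitPoint j b η x) {a : Fin 3 → k} (ha : a ⬝ᵥ x.rep ≠ 0) :
    (fun i => L.τ (a i)) ⬝ᵥ (fun l => IsLocalRing.residue L.V (η l)) ≠ 0 := by
  obtain ⟨i, hi⟩ := exists_rep_ne_zero x
  have h1 := eq_smul_of_forall_linForm L.τ hi h.dotProduct_eq_zero
  obtain ⟨e, he⟩ := h.exists_eq_one
  have h2 : IsLocalRing.residue L.V (η i) / L.τ (x.rep i) ≠ 0 := by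
    intro h0
    have h3 := h1 e
    rw [h0, zero_mul, he, map_one] at h3
    exact one_ne_zero h3
  have h3 : (fun i => L.τ (a i)) ⬝ᵥ (fun l => IsLocalRing.residue L.V (η l)) =
      IsLocalRing.residue L.V (η i) / L.τ (x.rep i) * L.τ (a ⬝ᵥ x.rep) := by
    simp only [dotProduct, map_sum, map_mul, Finset.mul_sum]
    refine Finset.sum_congr rfl fun l _ => ?_
    rw [h1 l]
    ring
  rw [h3]
  exact mul_ne_zero h2 ((map_ne_zero _).mpr ha)

theorem movedForm_eq (h : L.IsLimitPoint j b η x) (β : Fin 3 → k) :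
    (L.movedForm β ⬝ᵥ fun l => algebraMap k K (z j l)) =
      b * (((fun i => L.ι (β i)) ⬝ᵥ η : L.V) : K) := by
  rw [L.movedForm_dotProduct, dotProduct_comm, dotProduct_comm _ η]
  simp only [← L.ι_eq]
  exact dotProduct_scaled h.point_eq _

theorem valuation_movedForm_le (h : L.IsLimitPoint j b η x) (β : Fin 3 → k) :
    L.V.valuation (L.movedForm β ⬝ᵥ fun l => algebraMap k K (z j l)) ≤ L.V.valuation b := by
  rw [h.movedForm_eq]
  exact valuation_mul_le b _

theorem valuation_movedForm_eq (h : L.IsLimitPoint j b η x) {β : Fin 3 → k}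
    (hβ : β ⬝ᵥ x.rep ≠ 0) :
    L.V.valuation (L.movedForm β ⬝ᵥ fun l => algebraMap k K (z j l)) = L.V.valuation b := by
  rw [h.movedForm_eq, map_mul, valuation_eq_one_of_residue_ne_zero, mul_one]
  rw [residue_dotProduct]
  exact h.dotProduct_ne_zero hβ

theorem valuation_movedForm_lt (h : L.IsLimitPoint j b η x) {β : Fin 3 → k}
    (hβ : β ⬝ᵥ x.rep = 0) :
    L.V.valuation (L.movedForm β ⬝ᵥ fun l => algebraMap k K (z j l)) < L.V.valuation b := by
  have h1 : IsLocalRing.residue L.V ((fun i => L.ι (β i)) ⬝ᵥ η) = 0 := by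
    rw [residue_dotProduct]
    exact h.dotProduct_eq_zero β hβ
  rw [IsLocalRing.residue_eq_zero_iff, L.V.valuation_lt_one_iff] at h1
  rw [h.movedForm_eq, map_mul]
  exact mul_lt_of_lt_one_right (zero_lt_iff.mpr ((Valuation.ne_zero_iff _).mpr h.ne_zero)) h1

end IsLimitPoint

variable {M : PlaneSubscheme.HilbertFrame k 6} (L : LimitFamily z M.coords K)

theorem eval₂_residue_eq_zero {j : Fin 6} {b : K} {η : Fin 3 → L.V} (hb : b ≠ 0)
    (hη : ∀ l, L.point j l = b * η l) {f : MvPolynomial (Fin 3) k} (hf : f.IsHomogeneous 6)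
    (hfM : f ∈ M.scheme.ideal) :
    MvPolynomial.eval₂ L.τ (fun l => IsLocalRing.residue L.V (η l)) f = 0 := by
  obtain ⟨F, hF, hFz, hFf⟩ := L.exists_lift hf hfM
  have h1 := hFz j
  rw [funext hη, MvPolynomial.aeval_def, eval₂_scaled_of_isHomogeneous _ hF] at h1
  have h2 : MvPolynomial.eval η F = 0 := by
    apply Subtype.val_injective
    have h3 := (mul_eq_zero.mp h1).resolve_left (pow_ne_zero _ hb)
    refine Eq.trans ?_ h3
    exact MvPolynomial.hom_eval₂ F (RingHom.id L.V) (algebraMap L.V K) η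
  have h4 := congrArg (IsLocalRing.residue L.V) h2
  rw [map_zero] at h4
  rw [← MvPolynomial.eval_map, ← hFf, MvPolynomial.eval_map]
  exact (MvPolynomial.hom_eval₂ F (RingHom.id L.V) (IsLocalRing.residue L.V) η).symm.trans h4

/-- The limit of each moving point is defined over `k`: otherwise, there are lines through `p`, `q`
and `r` which avoid it, and a product of them contains the limit subscheme. -/
theorem exists_isLimitPoint [IsAlgClosed k] {p q r : ℙ k (Fin 3 → k)}
    (h : M.scheme.HasQuadruplePoint p q r) {j : Fin 6} (hz : z j ≠ 0) :
    ∃ (b : K) (η : Fin 3 → L.V) (x : ℙ k (Fin 3 → k)),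
      L.IsLimitPoint j b η x := by
  obtain ⟨b, η, i, hb, hi, hη⟩ := exists_primitive_vector L.V _ (L.point_ne_zero hz)
  suffices hx : ∃ x : ℙ k (Fin 3 → k), ∀ a : Fin 3 → k, a ⬝ᵥ x.rep = 0 →
      (fun i => L.τ (a i)) ⬝ᵥ (fun l => IsLocalRing.residue L.V (η l)) = 0 by
    obtain ⟨x, hx⟩ := hx
    exact ⟨b, η, x, hb, ⟨i, hi⟩, hη, hx⟩
  by_contra hcon
  push Not at hcon
  obtain ⟨a₁, h1, h1'⟩ := hcon p
  obtain ⟨a₂, h2, h2'⟩ := hcon q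
  obtain ⟨a₃, h3, h3'⟩ := hcon r
  have h4 := L.eval₂_residue_eq_zero hb hη
    (((linForm_isHomogeneous a₃).pow 4).mul
      ((linForm_isHomogeneous a₁).mul (linForm_isHomogeneous a₂)))
    (h.prod_linForm_mem_ideal h1 h2 h3)
  rw [MvPolynomial.eval₂_mul, MvPolynomial.eval₂_mul, MvPolynomial.eval₂_pow, eval₂_linForm,
    eval₂_linForm, eval₂_linForm] at h4
  exact mul_ne_zero (pow_ne_zero 4 h3') (mul_ne_zero h1' h2') h4

/-- A product of linear forms through the limits of the six moving points contains the limit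
subscheme, since each of the linear forms lifts to one through the moving point. -/
theorem prod_linForm_mem_ideal {b : Fin 6 → K} {η : Fin 6 → Fin 3 → L.V}
    {x : Fin 6 → ℙ k (Fin 3 → k)} (h : ∀ j, L.IsLimitPoint j (b j) (η j) (x j))
    (a : Fin 6 → Fin 3 → k) (ha : ∀ j, a j ⬝ᵥ (x j).rep = 0) :
    ∏ j, linForm (a j) ∈ M.scheme.ideal := by
  have hlift : ∀ j, ∃ α : Fin 3 → L.V, α ⬝ᵥ η j = 0 ∧
      ∀ l, IsLocalRing.residue L.V (α l) = L.τ (a j l) := by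
    intro j
    obtain ⟨i, hi⟩ := (h j).exists_eq_one
    refine ⟨(fun l => L.ι (a j l)) - Pi.single i ((fun l => L.ι (a j l)) ⬝ᵥ η j), ?_, fun l => ?_⟩
    · simp [sub_dotProduct, hi]
    · have h1 : IsLocalRing.residue L.V ((fun l => L.ι (a j l)) ⬝ᵥ η j) = 0 := by
        rw [residue_dotProduct]
        exact (h j).dotProduct_eq_zero _ (ha j)
      rw [Pi.sub_apply, map_sub, Pi.single_apply, apply_ite (IsLocalRing.residue L.V), h1, map_zero,
        ite_self, sub_zero]
      rfl
  choose α hα hα' using hlift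
  refine L.mem_ideal_of_lift (F := ∏ j, linForm (α j)) ?_ (fun j => ?_) ?_ ?_
  · simpa using MvPolynomial.IsHomogeneous.prod Finset.univ (fun j => linForm (α j)) (fun _ => 1)
      fun j _ => linForm_isHomogeneous (α j)
  · rw [map_prod]
    refine Finset.prod_eq_zero (Finset.mem_univ j) ?_
    have h1 : (fun i => algebraMap L.V K (α j i)) ⬝ᵥ L.point j =
        b j * ((α j ⬝ᵥ η j : L.V) : K) := by
      rw [dotProduct_comm, dotProduct_comm (α j)]
      exact dotProduct_scaled (h j).point_eq (α j)
    rw [MvPolynomial.aeval_def, eval₂_linForm, h1, hα]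
    simp
  · simpa using MvPolynomial.IsHomogeneous.prod Finset.univ (fun j => linForm (a j)) (fun _ => 1)
      fun j _ => linForm_isHomogeneous (a j)
  · rw [map_prod, map_prod]
    refine Finset.prod_congr rfl fun j _ => ?_
    rw [map_linForm, map_linForm]
    simp only [hα']

end LimitFamily

/-! ### Linear substitutions over a ring -/

/-- The substitution of the linear forms with coefficients in the rows of `B` for the variables. -/
def changeOfVariables {A : Type*} [CommRing A] (B : Matrix (Fin 3) (Fin 3) A) :
    MvPolynomial (Fin 3) A →ₐ[A] MvPolynomial (Fin 3) A :=
  MvPolynomial.aeval fun i => linForm (B i)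

theorem changeOfVariables_isHomogeneous {A : Type*} [CommRing A] (B : Matrix (Fin 3) (Fin 3) A)
    {F : MvPolynomial (Fin 3) A} {d : ℕ} (hF : F.IsHomogeneous d) :
    (changeOfVariables B F).IsHomogeneous d := by
  simpa [changeOfVariables] using
    hF.aeval (n := 1) (fun i => linForm (B i)) fun i => linForm_isHomogeneous (B i)

theorem map_changeOfVariables {A A' : Type*} [CommRing A] [CommRing A'] (φ : A →+* A')
    (B : Matrix (Fin 3) (Fin 3) A) (F : MvPolynomial (Fin 3) A) :
    MvPolynomial.map φ (changeOfVariables B F) =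
      changeOfVariables (B.map φ) (MvPolynomial.map φ F) := by
  induction F using MvPolynomial.induction_on with
  | C a => simp [changeOfVariables]
  | add p q hp hq => simp [hp, hq]
  | mul_X p i hp =>
    rw [map_mul, map_mul, map_mul, map_mul, hp, MvPolynomial.map_X]
    congr 1
    simp only [changeOfVariables, MvPolynomial.aeval_X, map_linForm]
    rfl

theorem aeval_changeOfVariables {A A' : Type*} [CommRing A] [CommRing A'] [Algebra A A']
    (B : Matrix (Fin 3) (Fin 3) A) (F : MvPolynomial (Fin 3) A) (v : Fin 3 → A') :
    MvPolynomial.aeval v (changeOfVariables B F) =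
      MvPolynomial.aeval (fun i => (fun j => algebraMap A A' (B i j)) ⬝ᵥ v) F := by
  rw [changeOfVariables, ← AlgHom.comp_apply, MvPolynomial.comp_aeval]
  congr 2
  ext i
  exact eval₂_linForm _ _ _

theorem linearSubst_eq_changeOfVariables {k : Type*} [Field k] (B : GL (Fin 3) k)
    (f : MvPolynomial (Fin 3) k) : linearSubst B f = changeOfVariables B.val f := rfl

theorem eval_pderiv_map {A A' : Type*} [CommRing A] [CommRing A'] (φ : A →+* A')
    (f : MvPolynomial (Fin 3) A) (i : Fin 3) (v : Fin 3 → A) {v' : Fin 3 → A'}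
    (hv : ∀ l, v' l = φ (v l)) :
    MvPolynomial.eval v' (MvPolynomial.pderiv i (MvPolynomial.map φ f)) =
      φ (MvPolynomial.eval v (MvPolynomial.pderiv i f)) := by
  rw [MvPolynomial.pderiv_map, MvPolynomial.eval_map, funext hv]
  exact (MvPolynomial.hom_eval₂ _ (RingHom.id A) φ v).symm

/-- Representatives of three points that are not collinear are still linearly independent over a
larger field. -/
theorem eq_zero_of_independent {k κ : Type*} [Field k] [Field κ] (τ : k →+* κ)
    {x : Fin 3 → ℙ k (Fin 3 → k)} (hx : Projectivization.Independent x) {w : Fin 3 → κ}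
    (hw : ∀ i, (w ⬝ᵥ fun l => τ ((x i).rep l)) = 0) : w = 0 := by
  rw [Projectivization.independent_iff] at hx
  have h1 : IsUnit (Matrix.of fun i => (x i).rep) :=
    Matrix.linearIndependent_rows_iff_isUnit.mp hx
  rw [Matrix.isUnit_iff_isUnit_det] at h1
  have h2 : ((Matrix.of fun i => (x i).rep).map τ).det ≠ 0 := by
    rw [← RingHom.mapMatrix_apply, ← RingHom.map_det]
    exact (map_ne_zero _).mpr h1.ne_zero
  refine Matrix.eq_zero_of_mulVec_eq_zero h2 ?_
  ext i
  exact (dotProduct_comm _ _).trans (hw i)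

/-! ### Exclusion of the cycle `p + q + 4r` -/

open scoped Matrix

namespace PlaneSubscheme.HasQuadruplePoint

variable {k : Type*} [Field k] [IsAlgClosed k] {W : PlaneSubscheme k 6} {p q r : ℙ k (Fin 3 → k)}

/-- A subscheme with cycle `p + q + 4r` whose tangent space at `r` contains neither `p` nor `q` is
not a limit of projectively equivalent configurations of six points, no three of them collinear. -/
theorem notMem_closure_orbit (h : W.HasQuadruplePoint p q r) (hp : p ∉ W.tangentSpace r)
    (hq : q ∉ W.tangentSpace r) {Z : PlaneSubscheme k 6} {z : Fin 6 → ℙ k (Fin 3 → k)}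
    (hz : Function.Injective z) (hZ : Z.ideal = ⨅ i, pointIdeal (z i))
    (hind : ∀ i j l, i ≠ j → i ≠ l → j ≠ l → Projectivization.Independent ![z i, z j, z l]) :
    W ∉ closure (MulAction.orbit PGL(3, k) Z) := by
  intro hW
  obtain ⟨M, rfl, hM⟩ := exists_frame_of_mem_closure hz hZ hW
  obtain ⟨K, _, _, ⟨L⟩⟩ := exists_valuation_family hM
  choose b η x hx using fun j => L.exists_isLimitPoint h (z j).rep_nonzero
  have hr : M.scheme.ideal ≤ pointIdeal r :=
    M.scheme.ideal_le_pointIdeal (by rw [h.multiplicity_r]; simp)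
  obtain ⟨d, f, hf, hfW, hfp, hfq⟩ := M.scheme.exists_form_of_notMem_tangentSpace₂ hr hp hq
  have hgrad : formGradient r f ≠ 0 := by
    intro h0
    simp [h0] at hfp
  obtain ⟨⟨s, hs, hsr⟩, t, ht, htpq⟩ :=
    h.exists_indices (L.prod_linForm_mem_ideal hx) hf hfW hgrad
  obtain ⟨f₀, c, hf₀, hf₀W, hc, hgrad₀⟩ := h.exists_sextic hf hfW
  -- Coordinates in which `r = (1 : 0 : 0)`, `p = (0 : 0 : 1)` and the tangent line is `x₂ = 0`.
  have hfr := formGradient_dotProduct_rep hf (eval_eq_zero_of_mem_pointIdeal (hr hfW))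
  obtain ⟨B, hB0, hB2, hB1⟩ := exists_coordinates r.rep_nonzero hfr hfp
  have hBr := inv_row_dotProduct_column B hB0
  have hBp := inv_row_dotProduct_column B hB2
  have hgradB : ∀ j, ∑ l, formGradient r f l * B.val l j =
      if j = 2 then formGradient r f ⬝ᵥ p.rep else 0 := by
    intro j
    fin_cases j
    · simpa [hB0, dotProduct] using hfr
    · simpa using hB1
    · simp [hB2, dotProduct]
  have hBq : B⁻¹.val 2 ⬝ᵥ q.rep ≠ 0 := by
    have h1 : formGradient r f ᵥ* B.val = Pi.single 2 (formGradient r f ⬝ᵥ p.rep) := by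
      ext j
      rw [Pi.single_apply]
      exact hgradB j
    have h2 : formGradient r f =
        (formGradient r f ⬝ᵥ p.rep) • B⁻¹.val 2 := by
      have h3 : B.val * B⁻¹.val = 1 := by
        rw [← Units.val_mul, mul_inv_cancel, Units.val_one]
      have h4 := congrArg (fun v => v ᵥ* B⁻¹.val) h1
      simp only [Matrix.vecMul_vecMul, h3, Matrix.vecMul_one, Matrix.single_vecMul] at h4
      exact h4
    intro h0
    rw [h2, smul_dotProduct, h0, smul_zero] at hfq
    exact hfq rfl
  have h2t : ∀ i, B⁻¹.val 2 ⬝ᵥ (x (t i)).rep ≠ 0 := by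
    intro i
    rcases htpq i with h1 | h1
    · rw [h1, hBp]
      simp
    · rwa [h1]
  have h0s : ∀ i, B⁻¹.val 0 ⬝ᵥ (x (s i)).rep ≠ 0 := by
    intro i
    rw [hsr, hBr]
    simp
  obtain ⟨F, hF, hFz, hFf⟩ := L.exists_lift hf₀ hf₀W
  have hmap : MvPolynomial.map (IsLocalRing.residue L.V)
      (changeOfVariables (B.val.map L.ι) F) =
        MvPolynomial.map L.τ (linearSubst B f₀) := by
    rw [map_changeOfVariables, hFf, linearSubst_eq_changeOfVariables, map_changeOfVariables]
    rfl
  have hderiv : ∀ j, MvPolynomial.eval ![1, 0, 0] (MvPolynomial.pderiv j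
      (MvPolynomial.map (IsLocalRing.residue L.V)
        (changeOfVariables (B.val.map L.ι) F))) =
      L.τ (c * if j = 2 then formGradient r f ⬝ᵥ p.rep else 0) := by
    intro j
    rw [hmap, eval_pderiv_map L.τ _ j ![1, 0, 0] (fun l => by fin_cases l <;> simp),
      eval_pderiv_linearSubst]
    have h1 : B.val.mulVec ![1, 0, 0] = r.rep := by
      ext i
      simp [Matrix.mulVec, dotProduct, Fin.sum_univ_three, hB0]
    have h2 : ∀ i, MvPolynomial.eval r.rep (MvPolynomial.pderiv i f₀) = c * formGradient r f i :=
      fun i => congrFun hgrad₀ i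
    rw [h1, ← hgradB, Finset.mul_sum]
    simp only [h2, mul_assoc]
  refine no_degeneration (fun j l => L.ι ((z j).rep l)) (fun s hs w hw => ?_)
    (fun i => L.movedForm (B⁻¹.val i)) (changeOfVariables (B.val.map L.ι) F)
    (changeOfVariables_isHomogeneous _ hF) (fun j => ?_) ?_ ?_ s hs ?_ ?_ t ht ?_ ?_ ?_
  · refine eq_zero_of_independent L.τ (x := fun i => z (s i)) ?_ hw
    have h1 := hind (s 0) (s 1) (s 2) (hs.ne (by decide)) (hs.ne (by decide)) (hs.ne (by decide))
    convert h1 using 1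
    ext1 i
    fin_cases i <;> rfl
  · rw [aeval_changeOfVariables]
    refine Eq.trans ?_ (hFz j)
    congr 2
    simp only [L.ι_eq, L.movedForm_dotProduct]
    have h1 : (B.val.map (algebraMap k K)).mulVec
        ((B⁻¹.val.map (algebraMap k K)).mulVec (L.point j)) = L.point j := by
      rw [Matrix.mulVec_mulVec, ← Matrix.map_mul, ← Units.val_mul, mul_inv_cancel, Units.val_one,
        Matrix.map_one _ (map_zero _) (map_one _), Matrix.one_mulVec]
    refine Eq.trans ?_ h1
    ext i
    simp only [Matrix.mulVec, Matrix.map_apply]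
    refine congrArg (· ⬝ᵥ _) (funext fun l => ?_)
    exact L.ι_eq _
  · rw [hderiv]
    simp
  · rw [hderiv, map_ne_zero]
    simpa using ⟨hc, hfp⟩
  · intro i
    simp only [L.ι_eq]
    rw [(hx (s i)).valuation_movedForm_eq (h0s i)]
    exact (hx (s i)).valuation_movedForm_lt (by rw [hsr, hBr]; simp)
  · intro i
    simp only [L.ι_eq]
    rw [(hx (s i)).valuation_movedForm_eq (h0s i)]
    exact (hx (s i)).valuation_movedForm_lt (by rw [hsr, hBr]; simp)
  · intro i
    simp only [L.ι_eq]
    rw [(hx (t i)).valuation_movedForm_eq (h2t i)]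
    exact (hx (t i)).valuation_movedForm_le _
  · intro i
    simp only [L.ι_eq]
    rw [(hx (t i)).valuation_movedForm_eq (h2t i)]
    exact (hx (t i)).valuation_movedForm_le _
  · intro i
    simp only [L.ι_eq]
    rw [← Valuation.ne_zero_iff L.V.valuation, (hx (t i)).valuation_movedForm_eq (h2t i),
      Valuation.ne_zero_iff]
    exact (hx (t i)).ne_zero

end PlaneSubscheme.HasQuadruplePoint

end

theorem proposition5p6 {k : Type*} [Field k] [IsAlgClosed k] [CharZero k]
    (W : PlaneSubscheme k 6) (hW : W.IsCurvilinear) :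
    (∀ p q r : ℙ k (Fin 3 → k), p ≠ q → p ≠ r → q ≠ r →
      W.HasCycle (Finsupp.single p 1 + Finsupp.single q 1 + Finsupp.single r 4) →
      p ∉ W.tangentSpace r → q ∉ W.tangentSpace r →
      ∀ Z : PlaneSubscheme k 6, Z.IsStarFree → W ∉ closure (MulAction.orbit PGL(3, k) Z)) ∧
    (∀ p r : ℙ k (Fin 3 → k), p ≠ r →
      W.HasCycle (Finsupp.single p 2 + Finsupp.single r 4) →
      p ∉ W.tangentSpace r →
      ∀ Z : PlaneSubscheme k 6, Z.IsStarFree → W ∉ closure (MulAction.orbit PGL(3, k) Z)) := by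
  constructor
  · rintro p q r - hpr hqr hD hp hq Z ⟨z, hz, hZ, hind, -⟩
    exact PlaneSubscheme.HasQuadruplePoint.notMem_closure_orbit ⟨hpr, hqr, hD⟩ hp hq hz hZ hind
  · rintro p r hpr hD hp Z ⟨z, hz, hZ, hind, -⟩
    refine PlaneSubscheme.HasQuadruplePoint.notMem_closure_orbit ⟨hpr, hpr, ?_⟩ hp hp hz hZ hind
    rwa [← Finsupp.single_add]
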